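/- **Model.** Let $\boldsymbol u_1^\star,\dots,\boldsymbol u_r^\star\in\mathbb R^d\setminus\{0\}$, $\boldsymbol T^\star=\sum_{l=1}^r(\boldsymbol u_l^\star)^{\otimes 3}\in\mathbb R^{d\times d\times d}$. Let $\Omega\subseteq[d]^3$ be a random symmetric index set such that the triples $(i,j,k)$ with $i\le j\le k$ belong to $\Omega$ independently, each with probability $p$. Let $\boldsymbol E$ be a symmetric random tensor, independent of $\Omega$, whose entries $E_{i,j,k}$, $i\le j\le k$, are i.i.d. $\mathcal N(0,\sigma^2)$ with $\sigma>0$. One observes $\boldsymbol T^{\mathsf{obs}}$ with $T^{\mathsf{obs}}_{i,j,k}=T^\star_{i,j,k}+E_{i,j,k}$ for $(i,j,k)\in\Omega$ and $T^{\mathsf{obs}}_{i,j,k}=0$ otherwise. **Assumptions on $\boldsymbol T^\star$.** $\|\boldsymbol T^\star\|_\infty\le\sqrt{\mu_0/d^3}\,\|\boldsymbol T^\star\|_{\mathrm F}$; $\|\boldsymbol u^\star_l\|_\infty\le\sqrt{\mu_1/d}\,\|\boldsymbol u^\star_l\|_2$ for all $l$; $|\langle \boldsymbol u^\star_l,\boldsymbol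 u^\star_m\rangle|\le\sqrt{\mu_2/d}\,\|\boldsymbol u^\star_l\|_2\|\boldsymbol u^\star_m\|_2$ for all $l\ne m$. Put $\mu=\max\{\mu_0,\mu_1,\mu_2\}$ and $\kappa=\max_l\|\boldsymbol u_l^\star\|_2^3/\min_l\|\boldsymbol u_l^\star\|_2^3$. **Variance parameters.** Let $\widetilde{\boldsymbol U}^\star=[\boldsymbol u_1^\star\otimes\boldsymbol u_1^\star,\dots,\boldsymbol u_r^\star\otimes\boldsymbol u_r^\star]\in\mathbb R^{d^2\times r}$, with rows indexed by pairs $(i,j)$, let $\boldsymbol D_k^\star\in\mathbb R^{d^2\times d^2}$ be the diagonal matrix with $((i,j),(i,j))$ entry $\mathrm{Var}(E_{i,j,k})=\sigma^2$, and let $$\boldsymbol\Sigma_k^\star=\tfrac2p(\widetilde{\boldsymbol U}^{\star\top}\widetilde{\boldsymbol U}^\star)^{-1}\widetilde{\boldsymbol U}^{\star\top}\boldsymbol D_k^\star\widetilde{\boldsymbol U}^\star(\widetilde{\boldsymbol U}^{\star\top}\widetilde{\boldsymbol U}^\star)^{-1}.$$ With $q_{a,b;c}=\widetilde{\boldsymbol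 U}^\star_{(a,b),:}\boldsymbol\Sigma^\star_c(\widetilde{\boldsymbol U}^\star_{(a,b),:})^\top$ let, for distinct $i,j,k$, $v^\star_{i,j,k}=q_{j,k;i}+q_{i,k;j}+q_{i,j;k}$, $v^\star_{i,i,k}=4q_{i,k;i}+q_{i,i;k}$, $v^\star_{i,i,i}=9q_{i,i;i}$, and let $v^\star$ be symmetric in its indices. **Unbiasedness.** Everything is conditional on $\Omega$. An estimator is a measurable function of $\boldsymbol T^{\mathsf{obs}}$ (it may depend on $\Omega$, $p$, $\sigma$). It is called unbiased for a function $\theta(\boldsymbol U)$ of the factors at $\boldsymbol U^\star=[\boldsymbol u^\star_1,\dots,\boldsymbol u^\star_r]$ if its expectation, given $\Omega$, under factors $\boldsymbol U$ exists for all $\boldsymbol U$ near $\boldsymbol U^\star$, and if its bias (expectation minus $\theta(\boldsymbol U)$) vanishes at $\boldsymbol U=\boldsymbol U^\star$ together with its derivative in $\boldsymbol U$. In particular this holds for each estimator that is exactly unbiased for all $\boldsymbol U$ in a neighbourhood of $\boldsymbol U^\star$. **Theorem.** (a) Suppose $\mu,\kappa,r=O(1)$ and $p\ge c_6\,\log^2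 d/d^2$ for some sufficiently large constant $c_6>0$. Then with probability at least $1-O(d^{-10})$ over $\Omega$, the following holds: for all $1\le l\le r$, $1\le k\le d$, every unbiased estimator $\widehat u_{l,k}$ of $u^\star_{l,k}$ has $$\mathrm{Var}[\widehat u_{l,k}]\ \ge\ (1-o(1))\,(\boldsymbol\Sigma^\star_k)_{l,l},$$ and for all $1\le i,j,k\le d$ every unbiased estimator $\widehat T_{i,j,k}$ of $T^\star_{i,j,k}$ has $$\mathrm{Var}[\widehat T_{i,j,k}]\ \ge\ (1-o(1))\,v^\star_{i,j,k}.$$ Here variances are conditional on $\Omega$ and may be infinite, $c_6$, the constant in $O(d^{-10})$ and the sequence $o(1)$ (as $d\to\infty$) depend only on the upper bounds for $\mu,\kappa,r$. (b) The same conclusion holds if only $\kappa=O(1)$ is assumed, $\mu$ and $r$ may grow with $d$, and $$p\ \ge\ c_6\,\frac{\mu^2 r\log^2 d}{d^2},\qquad r\ \le\ c_7\sqrt{\frac{d}{\mu\log d}}$$ for some sufficiently large constant $c_6>0$ and some sufficiently small constant $c_7>0$; here the constants and the sequence $o(1)$ depend only on the upper bound for $\kappa$. -/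

import Mathlib

open MeasureTheory ProbabilityTheory Filter Topology
open scoped NNReal ENNReal Matrix

namespace TensorCompletion

noncomputable section

/-- A real `d × d × d` array. -/
abbrev Tensor (d : ℕ) := Fin d → Fin d → Fin d → ℝ

/-- The factors `u_1, …, u_r ∈ ℝ^d`; the entry `u_{l,i}` is `U l i` and `‖U l‖` is the
Euclidean norm. -/
abbrev Factors (d r : ℕ) := Fin r → EuclideanSpace ℝ (Fin d)

/-- Index set of the independent entries of a symmetric tensor: unordered triples from `[d]` with
repetitions allowed, in bijection with the triples `i ≤ j ≤ k`. -/
abbrev Triple (d : ℕ) := Sym (Fin d) 3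

/-- The unordered triple underlying `(i, j, k)`. -/
def triple {d : ℕ} (i j k : Fin d) : Triple d := i ::ₛ j ::ₛ k ::ₛ Sym.nil

/-- `T = ∑_l u_l ⊗ u_l ⊗ u_l`. -/
def cpTensor {d r : ℕ} (U : Factors d r) : Tensor d :=
  fun i j k => ∑ l, U l i * U l j * U l k

/-! ### Sampling and noise -/

/-- Law of the symmetric random index set: each unordered triple (that is, each `i ≤ j ≤ k`) is
included independently with probability `p`; the index `(i, j, k)` is observed iff
`triple i j k` is included. -/
def samplingLaw (d : ℕ) (p : unitInterval) : Measure (Set (Triple d)) :=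
  setBernoulli Set.univ p

/-- Law of the symmetric noise tensor with i.i.d. `N(0, σ²)` entries `E_{i,j,k}`, `i ≤ j ≤ k`;
the `(i, j, k)` entry of the noise tensor is the coordinate `triple i j k`. -/
def noiseLaw (d : ℕ) (σ : ℝ≥0) : Measure (Triple d → ℝ) :=
  Measure.pi fun _ => gaussianReal 0 (σ ^ 2)

open Classical in
/-- The observed tensor: `T_{i,j,k} + E_{i,j,k}` on the sampled index set, and `0` elsewhere. -/
def observe {d r : ℕ} (U : Factors d r) (S : Set (Triple d)) (e : Triple d → ℝ) : Tensor d :=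
  fun i j k => if triple i j k ∈ S then cpTensor U i j k + e (triple i j k) else 0

/-- Law of the observed tensor given the sampled index set `S`, when the true factors are `U`. -/
def obsLaw {d r : ℕ} (σ : ℝ≥0) (S : Set (Triple d)) (U : Factors d r) : Measure (Tensor d) :=
  (noiseLaw d σ).map (observe U S)

/-! ### Unbiasedness -/

/-- `f` is an unbiased estimator of the parameter `target` at the true factors `U` (given the
sampled index set `S`): its expectation exists for all factors `V` near `U`, and its bias
`V ↦ E_V[f] - target V` vanishes at `U` to first order. An estimator that is exactly unbiased for
all `V` in some neighbourhood of `U` has this property (`IsUnbiasedAt.of_eventually`), so a lower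
bound for the variance of all `f` with this property covers every such estimator. -/
structure IsUnbiasedAt {d r : ℕ} (σ : ℝ≥0) (S : Set (Triple d)) (U : Factors d r)
    (f : Tensor d → ℝ) (target : Factors d r → ℝ) : Prop where
  measurable : Measurable f
  integrable : ∀ᶠ V in 𝓝 U, Integrable f (obsLaw σ S V)
  bias_eq_zero : ∫ y, f y ∂(obsLaw σ S U) - target U = 0
  deriv_bias_eq_zero : HasFDerivAt (fun V => ∫ y, f y ∂(obsLaw σ S V) - target V)
    (0 : Factors d r →L[ℝ] ℝ) U

theorem IsUnbiasedAt.of_eventually {d r : ℕ} {σ : ℝ≥0} {S : Set (Triple d)} {U : Factors d r}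
    {f : Tensor d → ℝ} {target : Factors d r → ℝ} (hf : Measurable f)
    (h : ∀ᶠ V in 𝓝 U, Integrable f (obsLaw σ S V) ∧ ∫ y, f y ∂(obsLaw σ S V) = target V) :
    IsUnbiasedAt σ S U f target where
  measurable := hf
  integrable := h.mono fun _ hV => hV.1
  bias_eq_zero := sub_eq_zero.2 h.self_of_nhds.2
  deriv_bias_eq_zero :=
    (hasFDerivAt_const (0 : ℝ) U).congr_of_eventuallyEq (h.mono fun _ hV => sub_eq_zero.2 hV.2)

/-! ### Incoherence and conditioning -/

/-- `κ = λ_max / λ_min`, where `λ_max` and `λ_min` are the maximum and minimum of `‖u_l‖³`. -/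
def condNumber {d r : ℕ} (U : Factors d r) : ℝ :=
  (⨆ l, ‖U l‖ ^ 3) / (⨅ l, ‖U l‖ ^ 3)

/-- Incoherence with parameters `μ₀, μ₁, μ₂`, and nonzero factors with condition number at most
`K`. -/
structure IsIncoherent {d r : ℕ} (U : Factors d r) (μ₀ μ₁ μ₂ K : ℝ) : Prop where
  tensor_entry : ∀ i j k, |cpTensor U i j k| ≤
    √(μ₀ / (d : ℝ) ^ 3) * √(∑ i', ∑ j', ∑ k', cpTensor U i' j' k' ^ 2)
  factor_entry : ∀ l i, |U l i| ≤ √(μ₁ / (d : ℝ)) * ‖U l‖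
  factor_inner : ∀ l m, l ≠ m → |inner ℝ (U l) (U m)| ≤ √(μ₂ / (d : ℝ)) * ‖U l‖ * ‖U m‖
  factor_ne_zero : ∀ l, U l ≠ 0
  cond_le : condNumber U ≤ K

/-! ### The variance parameters -/

/-- The `d² × r` matrix `Ũ = [u_1 ⊗ u_1, …, u_r ⊗ u_r]`. -/
def liftedFactors {d r : ℕ} (U : Factors d r) : Matrix (Fin d × Fin d) (Fin r) ℝ :=
  Matrix.of fun q l => U l q.1 * U l q.2

/-- The diagonal matrix `D_k` of the noise variances in the `k`-th slice, for the array `s` of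
noise variances `σ_{i,j,k}²`. -/
def noiseSlice {d : ℕ} (s : Tensor d) (k : Fin d) : Matrix (Fin d × Fin d) (Fin d × Fin d) ℝ :=
  Matrix.diagonal fun q => s q.1 q.2 k

/-- `Σ_k = (2/p) (ŨᵀŨ)⁻¹ Ũᵀ D_k Ũ (ŨᵀŨ)⁻¹`. -/
def factorCov {d r : ℕ} (p : ℝ) (s : Tensor d) (U : Factors d r) (k : Fin d) :
    Matrix (Fin r) (Fin r) ℝ :=
  (2 / p) • (((liftedFactors U)ᵀ * liftedFactors U)⁻¹ * (liftedFactors U)ᵀ * noiseSlice s k *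
    liftedFactors U * ((liftedFactors U)ᵀ * liftedFactors U)⁻¹)

/-- The quadratic form `Ũ_{(a,b),:} Σ_c (Ũ_{(a,b),:})ᵀ`. -/
def rowForm {d r : ℕ} (p : ℝ) (s : Tensor d) (U : Factors d r) (a b c : Fin d) : ℝ :=
  liftedFactors U (a, b) ⬝ᵥ (factorCov p s U c *ᵥ liftedFactors U (a, b))

/-- The variance parameter `v_{i,j,k}`, symmetric in its three indices. -/
def entryVar {d r : ℕ} (p : ℝ) (s : Tensor d) (U : Factors d r) (i j k : Fin d) : ℝ :=
  if i = j then
    if j = k then 9 * rowForm p s U i i i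
    else 4 * rowForm p s U i k i + rowForm p s U i i k
  else if j = k then 4 * rowForm p s U j i j + rowForm p s U j j i
  else if i = k then 4 * rowForm p s U i j i + rowForm p s U i i j
  else rowForm p s U j k i + rowForm p s U i k j + rowForm p s U i j k

/-! ### The lower bounds -/

/-- The set of the sampled index sets `S` for which, given `S`, every unbiased estimator of an entry
of a factor has variance at least `(1 - δ) (Σ_k)_{l,l}`, and every unbiased estimator of an entry of
the tensor has variance at least `(1 - δ) v_{i,j,k}`. Variances are `[0, ∞]`-valued. -/
def lowerBoundEvent {d r : ℕ} (p : ℝ) (σ : ℝ≥0) (U : Factors d r) (δ : ℝ) :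
    Set (Set (Triple d)) :=
  {S | (∀ (l : Fin r) (k : Fin d) (uhat : Tensor d → ℝ),
          IsUnbiasedAt σ S U uhat (fun V => V l k) →
          ENNReal.ofReal ((1 - δ) * factorCov p (fun _ _ _ => (σ : ℝ) ^ 2) U k l l) ≤
            evariance uhat (obsLaw σ S U)) ∧
       (∀ (i j k : Fin d) (That : Tensor d → ℝ),
          IsUnbiasedAt σ S U That (fun V => cpTensor V i j k) →
          ENNReal.ofReal ((1 - δ) * entryVar p (fun _ _ _ => (σ : ℝ) ^ 2) U i j k) ≤
            evariance That (obsLaw σ S U))}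

end

end TensorCompletion

namespace TensorCompletion

/-! ### Gaussian shifts and a Chapman–Robbins bound -/

/-! The result is a Cramér–Rao bound along one well-chosen direction per target. Given the sampled
set `S`, replacing the factors `U` by `U + t • h` only translates the Gaussian noise. Cauchy–Schwarz
against the likelihood ratio (Chapman–Robbins, `sq_integral_comp_add_sub_le`), followed by `t → 0`,
gives `D² ≤ Var · I_S(h) / σ²`. Here `D` is the derivative of the target along `h`, and `I_S(h)`
sums the squared tangent tensor over the sampled unordered triples
(`IsUnbiasedAt.sq_mul_le_variance_mul`).

The tangent tensor is a sum of three terms, one per mode, each built from the matrices `∑_l h_{l,i}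
u_l ⊗ u_l`. Let `G = ŨᵀŨ`, let `h_i` be the `i`-th row of `h`, and let `W = ∑_i h_iᵀ G h_i` be the
total energy. Summed over the cube, the three squares give `3W`, and a triple of distinct indices is
counted six times; this is the source of the factor `1/2`. If `h` has at most three nonzero rows,
incoherence makes the cross terms and the diagonal triples `O(rρ) W` with `ρ = μ/d`
(`FactorIncoherence.sum_sq_symTangent_le`). Hence the mean of `I_S(h)` is at most `p W (1/2 +
O(rρ))`.

With `w_i` the gradient of the target in row `i`, the quotient `D²/W` is maximal at `h_i = G⁻¹ w_i`,
where `D = W = ∑_i w_iᵀ G⁻¹ w_i`. The resulting bound `2σ²W/p` is exactly `(Σ_k)_{l,l}` or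
`v_{i,j,k}`, up to the factor `1 - o(1)`.

The information has to be bounded only from above and only along `rd + d³` fixed directions, so a
scalar Chernoff bound and a union bound suffice, without spectral control of the full Fisher
information. Each summand is at most `18 rρ² W`, so `p ≳ rρ² log² d` allows a relative deviation
`1/√(log d)`. -/

theorem sq_integral_mul_le {Ω : Type*} [MeasurableSpace Ω] {μ : Measure Ω} {g h : Ω → ℝ}
    (hg : MemLp g 2 μ) (hh : MemLp h 2 μ) :
    (∫ x, g x * h x ∂μ) ^ 2 ≤ (∫ x, g x ^ 2 ∂μ) * ∫ x, h x ^ 2 ∂μ := by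
  have hgh : Integrable (fun x => g x * h x) μ := hg.integrable_mul hh
  -- The quadratic `t ↦ ∫ (g + t h)²` is nonnegative; its discriminant gives Cauchy–Schwarz.
  have key : ∀ t : ℝ, 0 ≤ (∫ x, h x ^ 2 ∂μ) * (t * t) + (2 * ∫ x, g x * h x ∂μ) * t
      + ∫ x, g x ^ 2 ∂μ := by
    intro t
    have h0 : 0 ≤ ∫ x, (h x ^ 2 * (t * t) + 2 * (g x * h x) * t + g x ^ 2) ∂μ :=
      integral_nonneg fun x => by
        have := sq_nonneg (g x + t * h x)
        simp only [Pi.zero_apply]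
        linarith
    have hi : Integrable (fun x => h x ^ 2 * (t * t) + 2 * (g x * h x) * t) μ :=
      (hh.integrable_sq.mul_const _).add ((hgh.const_mul 2).mul_const t)
    rw [integral_add hi hg.integrable_sq, integral_add (hh.integrable_sq.mul_const _)
      ((hgh.const_mul 2).mul_const t), integral_mul_const, integral_mul_const,
      integral_const_mul] at h0
    exact h0
  have := discrim_le_zero key
  rw [discrim] at this
  linarith

/-- The density of `N(a, v)` with respect to `N(0, v)`. -/
noncomputable def shiftDensity (v : ℝ≥0) (a x : ℝ) : ℝ := Real.exp (a / v * x - a ^ 2 / (2 * v))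

theorem shiftDensity_pos (v : ℝ≥0) (a x : ℝ) : 0 < shiftDensity v a x := Real.exp_pos _

theorem measurable_shiftDensity (v : ℝ≥0) (a : ℝ) : Measurable (shiftDensity v a) := by
  unfold shiftDensity
  fun_prop

theorem gaussianReal_eq_withDensity {v : ℝ≥0} (hv : v ≠ 0) (a : ℝ) :
    gaussianReal a v =
      (gaussianReal 0 v).withDensity fun x => ENNReal.ofReal (shiftDensity v a x) := by
  have hv' : (v : ℝ) ≠ 0 := by exact_mod_cast hv
  rw [gaussianReal_of_var_ne_zero _ hv, gaussianReal_of_var_ne_zero _ hv,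
    ← withDensity_mul _ (measurable_gaussianPDF 0 v) (measurable_shiftDensity v a).ennreal_ofReal]
  congr 1
  ext x
  rw [Pi.mul_apply, gaussianPDF, gaussianPDF, ← ENNReal.ofReal_mul (gaussianPDFReal_nonneg _ _ _),
    gaussianPDFReal, gaussianPDFReal, shiftDensity, mul_assoc (√_)⁻¹, ← Real.exp_add]
  congr 3
  field_simp
  ring

theorem integrable_shiftDensity (v : ℝ≥0) (a : ℝ) :
    Integrable (shiftDensity v a) (gaussianReal 0 v) := by
  have h : shiftDensity v a =
      fun x => Real.exp (a / v * x) * Real.exp (-(a ^ 2 / (2 * v))) := by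
    ext x
    rw [shiftDensity, sub_eq_add_neg, Real.exp_add]
  rw [h]
  exact (integrable_exp_mul_gaussianReal (a / v)).mul_const _

theorem integral_exp_mul_gaussianReal (v : ℝ≥0) (t : ℝ) :
    ∫ x, Real.exp (t * x) ∂(gaussianReal 0 v) = Real.exp (v * t ^ 2 / 2) := by
  have := congrFun (mgf_fun_id_gaussianReal (μ := 0) (v := v)) t
  simpa [mgf] using this

theorem integral_shiftDensity {v : ℝ≥0} (hv : v ≠ 0) (a : ℝ) :
    ∫ x, shiftDensity v a x ∂(gaussianReal 0 v) = 1 := by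
  have hv' : (v : ℝ) ≠ 0 := by exact_mod_cast hv
  simp only [shiftDensity, sub_eq_add_neg, Real.exp_add]
  rw [integral_mul_const, integral_exp_mul_gaussianReal, ← Real.exp_add, ← Real.exp_zero]
  congr 1
  field_simp
  ring

theorem shiftDensity_sq (v : ℝ≥0) (a x : ℝ) : shiftDensity v a x ^ 2 =
    Real.exp (2 * a / v * x) * Real.exp (-(a ^ 2 / v)) := by
  rw [shiftDensity, ← Real.exp_add, ← Real.exp_nat_mul]
  congr 1
  push_cast
  field_simp
  ring

theorem integrable_shiftDensity_sq (v : ℝ≥0) (a : ℝ) :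
    Integrable (fun x => shiftDensity v a x ^ 2) (gaussianReal 0 v) := by
  simp only [shiftDensity_sq]
  exact (integrable_exp_mul_gaussianReal (2 * a / v)).mul_const _

theorem integral_shiftDensity_sq {v : ℝ≥0} (hv : v ≠ 0) (a : ℝ) :
    ∫ x, shiftDensity v a x ^ 2 ∂(gaussianReal 0 v) = Real.exp (a ^ 2 / v) := by
  have hv' : (v : ℝ) ≠ 0 := by exact_mod_cast hv
  simp only [shiftDensity_sq]
  rw [integral_mul_const, integral_exp_mul_gaussianReal, ← Real.exp_add]
  congr 1
  field_simp
  ring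

/-! ### Translations of product Gaussian measures -/

section Pi

variable {ι : Type*} [Fintype ι]

theorem integrable_prod_shiftDensity (v : ℝ≥0) (a : ι → ℝ) :
    Integrable (fun x : ι → ℝ => ∏ i, shiftDensity v (a i) (x i))
      (Measure.pi fun _ => gaussianReal 0 v) :=
  Integrable.fintype_prod (f := fun i => shiftDensity v (a i))
    fun i => integrable_shiftDensity v (a i)

/-- A product measure is determined by boxes, and on a box the indicator times the density factors
over the coordinates, which reduces the claim to dimension one. -/
theorem map_add_pi_gaussianReal {v : ℝ≥0} (hv : v ≠ 0) (a : ι → ℝ) :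
    (Measure.pi fun _ : ι => gaussianReal 0 v).map (fun x => x + a) =
      (Measure.pi fun _ => gaussianReal 0 v).withDensity
        fun x => ENNReal.ofReal (∏ i, shiftDensity v (a i) (x i)) := by
  have h1 : (Measure.pi fun _ : ι => gaussianReal 0 v).map (fun x => x + a) =
      Measure.pi fun i => gaussianReal (a i) v := by
    have hm : ∀ i : ι, AEMeasurable (fun y : ℝ => y + a i) (gaussianReal 0 v) := fun i => by
      fun_prop
    have : ∀ i : ι, SigmaFinite ((gaussianReal 0 v).map fun y : ℝ => y + a i) := fun i => by
      rw [gaussianReal_map_add_const]; infer_instance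
    have := Measure.pi_map_pi (μ := fun _ : ι => gaussianReal 0 v)
      (f := fun i (y : ℝ) => y + a i) hm
    simp only [gaussianReal_map_add_const, zero_add] at this
    exact this
  rw [h1]
  refine Measure.pi_eq fun s hs => ?_
  rw [withDensity_apply _ (MeasurableSet.univ_pi hs),
    ← ofReal_integral_eq_lintegral_ofReal (integrable_prod_shiftDensity v a).integrableOn
      (ae_of_all _ fun x => Finset.prod_nonneg fun i _ => (shiftDensity_pos _ _ _).le),
    ← integral_indicator (MeasurableSet.univ_pi hs)]
  have h2 : ∀ x : ι → ℝ, (Set.univ.pi s).indicator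
      (fun x : ι → ℝ => ∏ i, shiftDensity v (a i) (x i)) x =
      ∏ i, (s i).indicator (shiftDensity v (a i)) (x i) := by
    intro x
    classical
    by_cases hx : x ∈ Set.univ.pi s
    · rw [Set.indicator_of_mem hx]
      exact Finset.prod_congr rfl fun i _ => (Set.indicator_of_mem (hx i trivial) _).symm
    · rw [Set.indicator_of_notMem hx]
      simp only [Set.mem_univ_pi, not_forall] at hx
      obtain ⟨i, hi⟩ := hx
      exact (Finset.prod_eq_zero (Finset.mem_univ i) (Set.indicator_of_notMem hi _)).symm
  simp only [h2]
  rw [integral_fintype_prod_eq_prod (fun i => (s i).indicator (shiftDensity v (a i))),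
    ENNReal.ofReal_prod_of_nonneg fun i _ => integral_nonneg fun x =>
      Set.indicator_nonneg (fun y _ => (shiftDensity_pos v (a i) y).le) x]
  refine Finset.prod_congr rfl fun i _ => ?_
  rw [integral_indicator (hs i), gaussianReal_eq_withDensity hv (a i),
    withDensity_apply _ (hs i), ← ofReal_integral_eq_lintegral_ofReal
      (integrable_shiftDensity v (a i)).integrableOn
      (ae_of_all _ fun x => (shiftDensity_pos _ _ _).le)]

theorem integral_comp_add_pi_gaussianReal {v : ℝ≥0} (hv : v ≠ 0) (a : ι → ℝ)
    {F : (ι → ℝ) → ℝ} (hF : Measurable F) :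
    ∫ x, F (x + a) ∂(Measure.pi fun _ => gaussianReal 0 v) =
      ∫ x, (∏ i, shiftDensity v (a i) (x i)) * F x ∂(Measure.pi fun _ => gaussianReal 0 v) := by
  rw [← integral_map (φ := fun x : ι → ℝ => x + a) (by fun_prop) hF.aestronglyMeasurable,
    map_add_pi_gaussianReal hv, integral_withDensity_eq_integral_toReal_smul]
  · refine integral_congr_ae (ae_of_all _ fun x => ?_)
    simp only [smul_eq_mul]
    rw [ENNReal.toReal_ofReal (Finset.prod_nonneg fun i _ => (shiftDensity_pos _ _ _).le)]
  · refine Measurable.ennreal_ofReal (Finset.measurable_fun_prod _ fun i _ => ?_)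
    exact (measurable_shiftDensity v (a i)).comp (measurable_pi_apply i)
  · exact ae_of_all _ fun x => ENNReal.ofReal_lt_top

theorem memLp_two_prod_shiftDensity (v : ℝ≥0) (a : ι → ℝ) :
    MemLp (fun x : ι → ℝ => ∏ i, shiftDensity v (a i) (x i)) 2
      (Measure.pi fun _ => gaussianReal 0 v) := by
  rw [memLp_two_iff_integrable_sq (integrable_prod_shiftDensity v a).aestronglyMeasurable]
  simp only [← Finset.prod_pow]
  exact Integrable.fintype_prod (f := fun i x => shiftDensity v (a i) x ^ 2)
    fun i => integrable_shiftDensity_sq v (a i)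

/-- Chapman–Robbins: the change of the mean is the covariance of `F` with the likelihood ratio `w`,
and the variance of `w` (the χ²-divergence of the two Gaussians) is the last factor. -/
theorem sq_integral_comp_add_sub_le {v : ℝ≥0} (hv : v ≠ 0) (a : ι → ℝ)
    {F : (ι → ℝ) → ℝ} (hF : Measurable F)
    (hF2 : MemLp F 2 (Measure.pi fun _ => gaussianReal 0 v)) :
    (∫ x, F (x + a) ∂(Measure.pi fun _ => gaussianReal 0 v) -
        ∫ x, F x ∂(Measure.pi fun _ => gaussianReal 0 v)) ^ 2 ≤
      Var[F; Measure.pi fun _ => gaussianReal 0 v] * (Real.exp ((∑ i, a i ^ 2) / v) - 1) := by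
  set N : Measure (ι → ℝ) := Measure.pi fun _ => gaussianReal 0 v with hN
  set w : (ι → ℝ) → ℝ := fun x => ∏ i, shiftDensity v (a i) (x i) with hw
  have hw2 : MemLp w 2 N := memLp_two_prod_shiftDensity v a
  have hwi : Integrable w N := integrable_prod_shiftDensity v a
  have hFi : Integrable F N := hF2.integrable one_le_two
  have hwF : Integrable (fun x => w x * F x) N := hw2.integrable_mul hF2
  have hw1 : ∫ x, w x ∂N = 1 := by
    rw [hw, hN, integral_fintype_prod_eq_prod (fun i => shiftDensity v (a i))]
    simp [integral_shiftDensity hv]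
  have hwsq : ∫ x, w x ^ 2 ∂N = Real.exp ((∑ i, a i ^ 2) / v) := by
    simp only [hw, ← Finset.prod_pow]
    rw [hN, integral_fintype_prod_eq_prod (fun i x => shiftDensity v (a i) x ^ 2),
      Finset.sum_div, Real.exp_sum]
    simp [integral_shiftDensity_sq hv]
  set m := ∫ x, F x ∂N with hm
  have h1 : ∫ x, F (x + a) ∂N - m = ∫ x, (F x - m) * (w x - 1) ∂N := by
    rw [integral_comp_add_pi_gaussianReal hv a hF]
    have : ∀ x, (F x - m) * (w x - 1) = (w x * F x - F x) - (m * w x - m) := fun x => by ring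
    simp only [this]
    have i1 : Integrable (fun x => w x * F x - F x) N := hwF.sub hFi
    have i2 : Integrable (fun x => m * w x - m) N := (hwi.const_mul m).sub (integrable_const m)
    rw [integral_sub i1 i2,
      integral_sub hwF hFi, integral_sub (hwi.const_mul m) (integrable_const m),
      integral_const_mul, hw1]
    simp [← hm]
    rfl
  have h2 : ∫ x, (w x - 1) ^ 2 ∂N = Real.exp ((∑ i, a i ^ 2) / v) - 1 := by
    have : ∀ x, (w x - 1) ^ 2 = w x ^ 2 - (2 * w x - 1) := fun x => by ring
    simp only [this]
    have i1 : Integrable (fun x => 2 * w x - 1) N := (hwi.const_mul 2).sub (integrable_const 1)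
    rw [integral_sub hw2.integrable_sq i1,
      integral_sub (hwi.const_mul 2) (integrable_const 1), integral_const_mul, hw1, hwsq]
    simp
    ring
  rw [h1, ← h2, variance_eq_integral hF.aemeasurable]
  exact sq_integral_mul_le (hF2.sub (memLp_const m)) (hw2.sub (memLp_const 1))

end Pi

/-! ### A Chernoff bound for sums over a Bernoulli random set -/

section Bernoulli

variable {ι : Type*} [Fintype ι]

theorem mgf_sum_indicator_setBernoulli (p : unitInterval) (x : ι → ℝ) (t : ℝ) :
    mgf (fun S : Set ι => ∑ i, S.indicator x i) (setBernoulli Set.univ p) t =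
      ∏ i, (1 + p * (Real.exp (t * x i) - 1)) := by
  classical
  have hmeas : Measurable fun q : ι → Prop => {i | q i} := MeasurableEquiv.setOfPred.measurable
  rw [mgf, setBernoulli_eq_map, integral_map hmeas.aemeasurable .of_discrete]
  have h : ∀ q : ι → Prop, Real.exp (t * ∑ i, {i | q i}.indicator x i) =
      ∏ i, (fun i (Q : Prop) => if Q then Real.exp (t * x i) else 1) i (q i) := by
    intro q
    rw [Finset.mul_sum, Real.exp_sum]
    refine Finset.prod_congr rfl fun i _ => ?_
    by_cases hq : q i <;> simp [Set.indicator, hq]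
  simp only [h]
  rw [Measure.infinitePi_eq_pi, integral_fintype_prod_eq_prod
    (fun i (Q : Prop) => if Q then Real.exp (t * x i) else 1)]
  refine Finset.prod_congr rfl fun i _ => ?_
  rw [integral_add_measure (.of_finite) (.of_finite)]
  simp only [Set.mem_univ]
  rw [integral_smul_nnreal_measure, integral_smul_nnreal_measure, integral_dirac, integral_dirac]
  simp [NNReal.smul_def]
  ring

/-- Exponential Markov inequality with `t = δ / (2B)`. Then `t xᵢ ≤ δ/2 ≤ 1`, so `exp (t xᵢ) - 1 ≤ t
xᵢ (1 + δ/2)`; half of the margin `δ` is left and yields the exponent `p m t δ / 2`. -/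
theorem setBernoulli_real_lt_sum_indicator_le (p : unitInterval) {x : ι → ℝ} {B m δ : ℝ}
    (hB : 0 < B) (hx0 : ∀ i, 0 ≤ x i) (hxB : ∀ i, x i ≤ B) (hm : ∑ i, x i ≤ m)
    (hδ0 : 0 ≤ δ) (hδ : δ ≤ 2) :
    (setBernoulli Set.univ p).real {S : Set ι | p * ((1 + δ) * m) < ∑ i, S.indicator x i} ≤
      Real.exp (-(p * m * δ ^ 2 / (4 * B))) := by
  set t : ℝ := δ / (2 * B) with ht
  have ht0 : 0 ≤ t := by positivity
  have htB : t * B = δ / 2 := by rw [ht]; field_simp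
  have hp := p.2.1
  have hm0 : 0 ≤ m := (Finset.sum_nonneg fun i _ => hx0 i).trans hm
  calc (setBernoulli Set.univ p).real {S : Set ι | p * ((1 + δ) * m) < ∑ i, S.indicator x i}
      ≤ (setBernoulli Set.univ p).real
        {S : Set ι | p * ((1 + δ) * m) ≤ ∑ i, S.indicator x i} :=
        by
        refine measureReal_mono fun S hS => ?_
        rw [Set.mem_ofPred_eq] at hS ⊢
        exact hS.le
    _ ≤ Real.exp (-t * (p * ((1 + δ) * m))) * mgf (fun S : Set ι => ∑ i, S.indicator x i)
          (setBernoulli Set.univ p) t :=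
        measure_ge_le_exp_mul_mgf _ ht0 .of_finite
    _ ≤ Real.exp (-t * (p * ((1 + δ) * m))) * Real.exp (p * (t * (1 + δ / 2) * m)) := by
        refine mul_le_mul_of_nonneg_left ?_ (Real.exp_pos _).le
        rw [mgf_sum_indicator_setBernoulli]
        calc ∏ i, (1 + p * (Real.exp (t * x i) - 1))
            ≤ ∏ i, Real.exp (p * (t * (1 + δ / 2) * x i)) := by
              refine Finset.prod_le_prod (fun i _ => ?_) fun i _ => ?_
              · have : 1 ≤ Real.exp (t * x i) := Real.one_le_exp (mul_nonneg ht0 (hx0 i))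
                have := mul_nonneg hp (sub_nonneg.2 this)
                linarith
              · have h0 : 0 ≤ t * x i := mul_nonneg ht0 (hx0 i)
                have h1 : t * x i ≤ δ / 2 := htB ▸ mul_le_mul_of_nonneg_left (hxB i) ht0
                have h2 := Real.abs_exp_sub_one_sub_id_le (x := t * x i)
                  (by rw [abs_of_nonneg h0]; linarith)
                have h3 : Real.exp (t * x i) - 1 ≤ t * (1 + δ / 2) * x i := by
                  have := (abs_le.1 h2).2
                  nlinarith [mul_le_mul_of_nonneg_left h1 h0]
                have h4 := Real.add_one_le_exp (p * (t * (1 + δ / 2) * x i))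
                have h5 := mul_le_mul_of_nonneg_left h3 hp
                linarith
          _ = Real.exp (p * (t * (1 + δ / 2) * ∑ i, x i)) := by
              rw [← Real.exp_sum, Finset.mul_sum, Finset.mul_sum]
          _ ≤ _ := Real.exp_le_exp.2 (by gcongr)
    _ = Real.exp (-(p * m * δ ^ 2 / (4 * B))) := by
        rw [← Real.exp_add]
        congr 1
        rw [ht]
        field_simp
        ring

end Bernoulli

/-! ### The Cramér–Rao bound for the observed tensor -/

variable {d r : ℕ}

/-- The entry of `∑_l u_l ⊗ u_l ⊗ u_l` at an unordered triple. -/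
noncomputable def symEntry (U : Factors d r) (s : Triple d) : ℝ :=
  ∑ l, ((s : Multiset (Fin d)).map (U l)).prod

theorem symEntry_triple (U : Factors d r) (i j k : Fin d) :
    symEntry U (triple i j k) = cpTensor U i j k := by
  change ∑ l, (Multiset.map (U l) (i ::ₘ j ::ₘ k ::ₘ 0)).prod = _
  simp [cpTensor, mul_assoc]

theorem exists_eq_triple (s : Triple d) : ∃ i j k, s = triple i j k := by
  obtain ⟨i, s, rfl⟩ := s.exists_eq_cons_of_succ
  obtain ⟨j, s, rfl⟩ := s.exists_eq_cons_of_succ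
  obtain ⟨k, s, rfl⟩ := s.exists_eq_cons_of_succ
  exact ⟨i, j, k, by rw [triple, Sym.eq_nil_of_card_zero s]⟩

/-- The derivative of `cpTensor` at `U` in the direction `h`. -/
noncomputable def tangentTensor (U h : Factors d r) : Tensor d :=
  fun i j k => ∑ l, (h l i * U l j * U l k + h l j * U l i * U l k + h l k * U l i * U l j)

theorem hasDerivAt_entry (U h : Factors d r) (l : Fin r) (i : Fin d) :
    HasDerivAt (fun t : ℝ => (U + t • h) l i) (h l i) 0 := by
  simpa using ((hasDerivAt_id (0 : ℝ)).mul_const (h l i)).const_add (U l i)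

theorem hasDerivAt_cpTensor (U h : Factors d r) (i j k : Fin d) :
    HasDerivAt (fun t : ℝ => cpTensor (U + t • h) i j k) (tangentTensor U h i j k) 0 := by
  unfold cpTensor tangentTensor
  refine HasDerivAt.fun_sum fun l _ => ?_
  refine (((hasDerivAt_entry U h l i).mul (hasDerivAt_entry U h l j)).mul
    (hasDerivAt_entry U h l k)).congr_deriv ?_
  simp
  ring

/-- `tangentTensor` at an unordered triple. -/
noncomputable def symTangent (U h : Factors d r) (s : Triple d) : ℝ :=
  deriv (fun t : ℝ => symEntry (U + t • h) s) 0

theorem hasDerivAt_symEntry (U h : Factors d r) (s : Triple d) :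
    HasDerivAt (fun t : ℝ => symEntry (U + t • h) s) (symTangent U h s) 0 := by
  obtain ⟨i, j, k, rfl⟩ := exists_eq_triple s
  have := hasDerivAt_cpTensor U h i j k
  simp only [← symEntry_triple] at this
  exact this.differentiableAt.hasDerivAt

theorem symTangent_triple (U h : Factors d r) (i j k : Fin d) :
    symTangent U h (triple i j k) = tangentTensor U h i j k := by
  have := hasDerivAt_cpTensor U h i j k
  simp only [← symEntry_triple] at this
  exact this.deriv

/-- The shift of the noise that turns the observation under `U` into the one under `V`. -/
noncomputable def shift (S : Set (Triple d)) (U V : Factors d r) (s : Triple d) : ℝ :=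
  S.indicator (fun s => symEntry V s - symEntry U s) s

/-- This turns the nonlinear model into a Gaussian location family: an estimator becomes a fixed
function of translated noise. -/
theorem observe_eq_observe_add_shift (S : Set (Triple d)) (U V : Factors d r) (e : Triple d → ℝ) :
    observe V S e = observe U S (e + shift S U V) := by
  ext i j k
  by_cases h : triple i j k ∈ S
  · simp only [observe, h, if_true, Pi.add_apply, shift, Set.indicator_of_mem, symEntry_triple]
    ring
  · simp [observe, h]

theorem measurable_observe (S : Set (Triple d)) (U : Factors d r) : Measurable (observe U S) := by
  refine measurable_pi_lambda _ fun i => measurable_pi_lambda _ fun j =>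
    measurable_pi_lambda _ fun k => ?_
  by_cases h : triple i j k ∈ S
  · simp only [observe, h, if_true]
    fun_prop
  · simp only [observe, h, if_false]
    fun_prop

theorem integral_obsLaw (σ : ℝ≥0) (S : Set (Triple d)) (U V : Factors d r) {f : Tensor d → ℝ}
    (hf : Measurable f) :
    ∫ y, f y ∂(obsLaw σ S V) = ∫ e, f (observe U S (e + shift S U V)) ∂(noiseLaw d σ) := by
  rw [obsLaw, integral_map (measurable_observe S V).aemeasurable hf.aestronglyMeasurable]
  simp only [observe_eq_observe_add_shift S U V]

instance isProbabilityMeasure_noiseLaw (σ : ℝ≥0) : IsProbabilityMeasure (noiseLaw d σ) := by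
  unfold noiseLaw
  infer_instance

instance isProbabilityMeasure_obsLaw (σ : ℝ≥0) (S : Set (Triple d)) (U : Factors d r) :
    IsProbabilityMeasure (obsLaw σ S U) :=
  Measure.isProbabilityMeasure_map (measurable_observe S U).aemeasurable

theorem sq_integral_obsLaw_sub_le {σ : ℝ≥0} (hσ : 0 < σ) (S : Set (Triple d)) (U V : Factors d r)
    {f : Tensor d → ℝ} (hf : Measurable f) (hf2 : MemLp f 2 (obsLaw σ S U)) :
    (∫ y, f y ∂(obsLaw σ S V) - ∫ y, f y ∂(obsLaw σ S U)) ^ 2 ≤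
      Var[f; obsLaw σ S U] * (Real.exp ((∑ s, shift S U V s ^ 2) / (σ : ℝ) ^ 2) - 1) := by
  have hU := (measurable_observe S U)
  rw [integral_obsLaw σ S U V hf, obsLaw, integral_map hU.aemeasurable hf.aestronglyMeasurable,
    variance_map hf.aestronglyMeasurable.aemeasurable hU.aemeasurable]
  have := sq_integral_comp_add_sub_le (v := σ ^ 2) (pow_ne_zero 2 hσ.ne') (shift S U V)
    (hf.comp hU) (hf2.comp_measurePreserving ⟨hU, rfl⟩)
  simpa [noiseLaw] using this

/-- The Fisher information of the observation at `U` in the direction `h`, up to the factor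
`σ⁻²`. -/
noncomputable def information (S : Set (Triple d)) (U h : Factors d r) : ℝ :=
  ∑ s, S.indicator (fun s => symTangent U h s ^ 2) s

theorem IsUnbiasedAt.hasDerivAt_integral {σ : ℝ≥0} {S : Set (Triple d)} {U : Factors d r}
    {f : Tensor d → ℝ} {θ : Factors d r → ℝ} (hf : IsUnbiasedAt σ S U f θ) {h : Factors d r}
    {D : ℝ} (hθ : HasDerivAt (fun t : ℝ => θ (U + t • h)) D 0) :
    HasDerivAt (fun t : ℝ => ∫ y, f y ∂(obsLaw σ S (U + t • h))) D 0 := by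
  have hline : HasDerivAt (fun t : ℝ => U + t • h) h 0 := by
    simpa using ((hasDerivAt_id (0 : ℝ)).smul_const h).const_add U
  have hb := hf.deriv_bias_eq_zero
  rw [show U = U + (0 : ℝ) • h by simp] at hb
  have h1 := (hb.comp_hasDerivAt (0 : ℝ) hline).add hθ
  simp only [_root_.zero_add, _root_.zero_apply] at h1
  refine h1.congr_of_eventuallyEq (Eventually.of_forall fun t => ?_)
  simp

/-- Cramér–Rao as a limit: Chapman–Robbins at `U + t • h` is divided by `t²` and `t → 0`. The
hypothesis on the bias supplies the derivative of the mean, so nothing is differentiated under the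
integral. -/
theorem IsUnbiasedAt.sq_mul_le_variance_mul {σ : ℝ≥0} (hσ : 0 < σ) {S : Set (Triple d)}
    {U : Factors d r} {f : Tensor d → ℝ} {θ : Factors d r → ℝ} (hf : IsUnbiasedAt σ S U f θ)
    (hf2 : MemLp f 2 (obsLaw σ S U)) {h : Factors d r} {D : ℝ}
    (hθ : HasDerivAt (fun t : ℝ => θ (U + t • h)) D 0) :
    D ^ 2 ≤ Var[f; obsLaw σ S U] * (information S U h / (σ : ℝ) ^ 2) := by
  set q : ℝ → ℝ := fun t => (∑ s, shift S U (U + t • h) s ^ 2) / (σ : ℝ) ^ 2 with hq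
  have hE := hasDerivAt_iff_tendsto_slope_zero.1 (hf.hasDerivAt_integral hθ)
  simp only [zero_add, zero_smul, add_zero, smul_eq_mul] at hE
  have hshift : ∀ s, HasDerivAt (fun t : ℝ => shift S U (U + t • h) s)
      (S.indicator (symTangent U h) s) 0 := by
    intro s
    by_cases hs : s ∈ S
    · simpa [shift, hs] using (hasDerivAt_symEntry U h s).sub_const (symEntry U s)
    · simpa [shift, hs] using hasDerivAt_const (0 : ℝ) (0 : ℝ)
  have hshift0 : ∀ s, shift S U U s = 0 := fun s => by simp [shift]
  have hq0 : Tendsto q (𝓝[≠] 0) (𝓝 0) := by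
    have : Tendsto q (𝓝 0) (𝓝 (q 0)) :=
      (tendsto_finsetSum _ fun s _ => ((hshift s).continuousAt.tendsto.pow 2)).div_const _
    simp only [hq, zero_smul, add_zero, hshift0] at this
    simpa [hq] using this.mono_left nhdsWithin_le_nhds
  have hq2 : Tendsto (fun t => t⁻¹ ^ 2 * q t) (𝓝[≠] 0)
      (𝓝 (information S U h / (σ : ℝ) ^ 2)) := by
    have h1 : ∀ s, Tendsto (fun t : ℝ => (t⁻¹ * shift S U (U + t • h) s) ^ 2) (𝓝[≠] 0)
        (𝓝 (S.indicator (fun s => symTangent U h s ^ 2) s)) := by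
      intro s
      have h2 := (hasDerivAt_iff_tendsto_slope_zero.1 (hshift s)).pow 2
      simp only [zero_add, zero_smul, add_zero, smul_eq_mul, hshift0, sub_zero] at h2
      convert h2 using 2
      by_cases hs : s ∈ S <;> simp [hs]
    have h3 := (tendsto_finsetSum Finset.univ fun s _ => h1 s).div_const ((σ : ℝ) ^ 2)
    refine h3.congr fun t => ?_
    simp only [hq, mul_pow, ← Finset.mul_sum]
    ring
  have hlim := (hq2.mul ((Real.continuous_exp.tendsto 0).comp hq0)).const_mul
    Var[f; obsLaw σ S U]
  rw [Real.exp_zero, mul_one] at hlim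
  refine le_of_tendsto_of_tendsto' (hE.pow 2) hlim fun t => ?_
  have h1 := sq_integral_obsLaw_sub_le hσ S U (U + t • h) hf.measurable hf2
  -- Since `q t → 0`, the extra factor `exp (q t)` disappears in the limit.
  have h2 : Real.exp (q t) - 1 ≤ q t * Real.exp (q t) := by
    have := mul_le_mul_of_nonneg_right (Real.add_one_le_exp (-q t)) (Real.exp_pos (q t)).le
    rw [← Real.exp_add, neg_add_cancel, Real.exp_zero] at this
    linarith
  calc _ = t⁻¹ ^ 2 * (∫ y, f y ∂(obsLaw σ S (U + t • h)) - ∫ y, f y ∂(obsLaw σ S U)) ^ 2 := by ring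
    _ ≤ t⁻¹ ^ 2 * (Var[f; obsLaw σ S U] * (q t * Real.exp (q t))) := by
        refine mul_le_mul_of_nonneg_left (h1.trans ?_) (sq_nonneg _)
        exact mul_le_mul_of_nonneg_left h2 (variance_nonneg _ _)
    _ = _ := by simp only [Function.comp]; ring

theorem IsUnbiasedAt.ofReal_le_evariance {σ : ℝ≥0} (hσ : 0 < σ) {S : Set (Triple d)}
    {U : Factors d r} {f : Tensor d → ℝ} {θ : Factors d r → ℝ} (hf : IsUnbiasedAt σ S U f θ)
    {h : Factors d r} {D : ℝ} (hθ : HasDerivAt (fun t : ℝ => θ (U + t • h)) D 0) {J : ℝ}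
    (hJ : 0 < J) (hinfo : information S U h ≤ J) :
    ENNReal.ofReal ((σ : ℝ) ^ 2 * D ^ 2 / J) ≤ evariance f (obsLaw σ S U) := by
  by_cases hf2 : MemLp f 2 (obsLaw σ S U)
  · rw [← ofReal_variance hf2]
    refine ENNReal.ofReal_le_ofReal ?_
    have hσ2 : 0 < (σ : ℝ) ^ 2 := by positivity
    have h1 := hf.sq_mul_le_variance_mul hσ hf2 hθ
    rw [div_le_iff₀ hJ]
    rw [← mul_div_assoc, le_div_iff₀ hσ2] at h1
    have := mul_le_mul_of_nonneg_left hinfo (variance_nonneg f (obsLaw σ S U))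
    linarith
  -- Without a second moment the extended variance is infinite.
  · rw [evariance_eq_top hf.measurable.aestronglyMeasurable hf2]
    exact le_top

/-! ### Sums over unordered triples -/

section Triples

variable {d : ℕ}

theorem triple_swap_left (i j k : Fin d) : triple i j k = triple j i k := Sym.cons_swap _ _ _

theorem triple_swap_right (i j k : Fin d) : triple i j k = triple i k j := by
  unfold triple
  rw [Sym.cons_swap j k]

/-- A triple of distinct indices has six orderings; one with a repetition has the form `{i, i, k}`
and is already covered by the second sum. -/
theorem sum_triple_le {φ : Triple d → ℝ} (hφ : ∀ s, 0 ≤ φ s) :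
    ∑ s, φ s ≤ 1 / 6 * ∑ i, ∑ j, ∑ k, φ (triple i j k) + ∑ i, ∑ k, φ (triple i i k) := by
  classical
  have h1 : ∑ i, ∑ j, ∑ k, φ (triple i j k) =
      ∑ s, ∑ x : Fin d × Fin d × Fin d with triple x.1 x.2.1 x.2.2 = s, φ s := by
    rw [Finset.sum_congr rfl fun s _ => Finset.sum_congr rfl fun x hx =>
        show φ s = φ (triple x.1 x.2.1 x.2.2) by rw [(Finset.mem_filter.1 hx).2],
      Finset.sum_fiberwise]
    simp only [Fintype.sum_prod_type]
  have h2 : ∑ i, ∑ k, φ (triple i i k) =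
      ∑ s, ∑ x : Fin d × Fin d with triple x.1 x.1 x.2 = s, φ s := by
    rw [Finset.sum_congr rfl fun s _ => Finset.sum_congr rfl fun x hx =>
        show φ s = φ (triple x.1 x.1 x.2) by rw [(Finset.mem_filter.1 hx).2],
      Finset.sum_fiberwise]
    simp only [Fintype.sum_prod_type]
  rw [h1, h2, Finset.mul_sum, ← Finset.sum_add_distrib]
  refine Finset.sum_le_sum fun s _ => ?_
  simp only [Finset.sum_const, nsmul_eq_mul]
  have key : (1 : ℝ) ≤ 1 / 6 * ((Finset.univ.filter fun x : Fin d × Fin d × Fin d =>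
      triple x.1 x.2.1 x.2.2 = s).card : ℝ) +
      ((Finset.univ.filter fun x : Fin d × Fin d => triple x.1 x.1 x.2 = s).card : ℝ) := by
    have hdiag : ∀ a b, triple a a b = s → (1 : ℝ) ≤
        ((Finset.univ.filter fun x : Fin d × Fin d => triple x.1 x.1 x.2 = s).card : ℝ) := by
      intro a b h
      exact_mod_cast Finset.card_pos.2 ⟨(a, b), by simpa using h⟩
    have hnn : (0 : ℝ) ≤ 1 / 6 * ((Finset.univ.filter fun x : Fin d × Fin d × Fin d =>
      triple x.1 x.2.1 x.2.2 = s).card : ℝ) := by positivity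
    obtain ⟨i, j, k, hs⟩ := exists_eq_triple s
    by_cases hij : i = j
    · linarith [hdiag i k (by rw [hs, hij])]
    by_cases hik : i = k
    · linarith [hdiag i j (by rw [hs, ← hik, triple_swap_right])]
    by_cases hjk : j = k
    · linarith [hdiag j i (by rw [hs, ← hjk, triple_swap_right, triple_swap_left])]
    have hsub : ({(i, j, k), (i, k, j), (j, i, k), (j, k, i), (k, i, j), (k, j, i)} :
        Finset (Fin d × Fin d × Fin d)) ⊆
        Finset.univ.filter fun x => triple x.1 x.2.1 x.2.2 = s := by
      intro x hx
      simp only [Finset.mem_insert, Finset.mem_singleton] at hx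
      simp only [Finset.mem_filter, Finset.mem_univ, true_and, hs]
      rcases hx with rfl | rfl | rfl | rfl | rfl | rfl
      · rfl
      · exact triple_swap_right _ _ _
      · exact triple_swap_left _ _ _
      · rw [triple_swap_right, triple_swap_left]
      · rw [triple_swap_left, triple_swap_right]
      · rw [triple_swap_left, triple_swap_right, triple_swap_left]
    have hcard := Finset.card_le_card hsub
    have h6 : ({(i, j, k), (i, k, j), (j, i, k), (j, k, i), (k, i, j), (k, j, i)} :
        Finset (Fin d × Fin d × Fin d)).card = 6 := by
      simp [hij, hik, hjk, Ne.symm hij, Ne.symm hik, Ne.symm hjk, Finset.card_insert_of_notMem]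
    rw [h6] at hcard
    have h6' : (6 : ℝ) ≤ ((Finset.univ.filter fun x : Fin d × Fin d × Fin d =>
      triple x.1 x.2.1 x.2.2 = s).card : ℝ) := by exact_mod_cast hcard
    have := Nat.cast_nonneg (α := ℝ)
      (Finset.univ.filter fun x : Fin d × Fin d => triple x.1 x.1 x.2 = s).card
    linarith
  have := mul_le_mul_of_nonneg_right key (hφ s)
  linarith

end Triples

/-! ### Size of the tangent tensor of a direction supported on few rows -/

section Tangent

variable {d r : ℕ}

/-- The matrix `∑_l c_l u_l ⊗ u_l`. -/
noncomputable def liftedComb (U : Factors d r) (c : Fin r → ℝ) (a b : Fin d) : ℝ :=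
  ∑ l, c l * U l a * U l b

/-- The squared Frobenius norm of `∑_l c_l u_l ⊗ u_l`. -/
noncomputable def energy (U : Factors d r) (c : Fin r → ℝ) : ℝ :=
  ∑ a, ∑ b, liftedComb U c a b ^ 2

/-- The squared norm of the coefficients of `∑_l c_l u_l ⊗ u_l` in the normalized factors. -/
noncomputable def weightedNormSq (U : Factors d r) (c : Fin r → ℝ) : ℝ :=
  ∑ l, (c l * ‖U l‖ ^ 2) ^ 2

/-- The squared norm of the row of index `(a, b)` of the lifted matrix of the normalized
factors. -/
noncomputable def rowNormSq (U : Factors d r) (a b : Fin d) : ℝ :=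
  ∑ l, (U l a * U l b / ‖U l‖ ^ 2) ^ 2

/-- Pairwise incoherence of nonzero factors, with parameter `ρ = μ / d`. -/
structure FactorIncoherence (U : Factors d r) (ρ : ℝ) : Prop where
  nonneg : 0 ≤ ρ
  ne_zero : ∀ l, U l ≠ 0
  entry : ∀ l i, U l i ^ 2 ≤ ρ * ‖U l‖ ^ 2
  inner_sq : ∀ l m, l ≠ m → (∑ a, U l a * U m a) ^ 2 ≤ ρ * (‖U l‖ ^ 2 * ‖U m‖ ^ 2)
  small : r * ρ ≤ 1 / 2

theorem liftedComb_comm (U : Factors d r) (c : Fin r → ℝ) (a b : Fin d) :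
    liftedComb U c a b = liftedComb U c b a :=
  Finset.sum_congr rfl fun l _ => by ring

theorem energy_nonneg (U : Factors d r) (c : Fin r → ℝ) : 0 ≤ energy U c :=
  Finset.sum_nonneg fun _ _ => Finset.sum_nonneg fun _ _ => sq_nonneg _

theorem weightedNormSq_nonneg (U : Factors d r) (c : Fin r → ℝ) : 0 ≤ weightedNormSq U c :=
  Finset.sum_nonneg fun _ _ => sq_nonneg _

/-- The Frobenius inner product of `u_l ⊗ u_l` and `u_m ⊗ u_m` is `⟨u_l, u_m⟩²`. -/
theorem energy_eq (U : Factors d r) (c : Fin r → ℝ) :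
    energy U c = ∑ l, ∑ m, c l * c m * (∑ a, U l a * U m a) ^ 2 := by
  calc energy U c
      = ∑ a, ∑ b, ∑ l, ∑ m, (c l * U l a * U l b) * (c m * U m a * U m b) := by
        simp only [energy, liftedComb, sq, Finset.sum_mul_sum]
    _ = ∑ l, ∑ a, ∑ b, ∑ m, (c l * U l a * U l b) * (c m * U m a * U m b) := by
        rw [Finset.sum_congr rfl fun a _ => Finset.sum_comm, Finset.sum_comm]
    _ = ∑ l, ∑ m, ∑ a, ∑ b, (c l * U l a * U l b) * (c m * U m a * U m b) := by
        refine Finset.sum_congr rfl fun l _ => ?_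
        rw [Finset.sum_congr rfl fun a _ => Finset.sum_comm, Finset.sum_comm]
    _ = _ := by
        refine Finset.sum_congr rfl fun l _ => Finset.sum_congr rfl fun m _ => ?_
        rw [sq, Finset.sum_mul_sum, Finset.mul_sum]
        refine Finset.sum_congr rfl fun a _ => ?_
        rw [Finset.mul_sum]
        exact Finset.sum_congr rfl fun b _ => by ring

theorem norm_sq_eq_sum (x : EuclideanSpace ℝ (Fin d)) : ‖x‖ ^ 2 = ∑ a, x a ^ 2 := by
  simp [EuclideanSpace.norm_sq_eq]

theorem sq_liftedComb_le (U : Factors d r) (hU : ∀ l, U l ≠ 0) (c : Fin r → ℝ) (a b : Fin d) :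
    liftedComb U c a b ^ 2 ≤ weightedNormSq U c * rowNormSq U a b := by
  have h : liftedComb U c a b = ∑ l, (c l * ‖U l‖ ^ 2) * (U l a * U l b / ‖U l‖ ^ 2) := by
    refine Finset.sum_congr rfl fun l _ => ?_
    have := norm_ne_zero_iff.2 (hU l)
    field_simp
  rw [h]
  exact Finset.sum_mul_sq_le_sq_mul_sq _ _ _

/-! ### Consequences of pairwise incoherence for the lifted factors -/

namespace FactorIncoherence

variable {U : Factors d r} {ρ : ℝ}

/-- The Gram matrix of the normalized lifted factors has unit diagonal and off-diagonal entries at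
most `ρ`, so it differs from the identity by a form of size at most `rρ ≤ 1/2`. -/
theorem weightedNormSq_le (hU : FactorIncoherence U ρ) (c : Fin r → ℝ) :
    weightedNormSq U c ≤ 2 * energy U c := by
  set w : Fin r → ℝ := fun l => c l * ‖U l‖ ^ 2 with hw
  have h1 : ∀ l m, (if l = m then w l ^ 2 else 0) - ρ * (|w l| * |w m|) ≤
      c l * c m * (∑ a, U l a * U m a) ^ 2 := by
    intro l m
    by_cases hlm : l = m
    · subst hlm
      have : ∑ a, U l a * U l a = ‖U l‖ ^ 2 := by
        rw [norm_sq_eq_sum]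
        exact Finset.sum_congr rfl fun a _ => (sq _).symm
      rw [if_pos rfl, this]
      have : c l * c l * (‖U l‖ ^ 2) ^ 2 = w l ^ 2 := by rw [hw]; ring
      rw [this]
      linarith [mul_nonneg hU.nonneg (mul_nonneg (abs_nonneg (w l)) (abs_nonneg (w l)))]
    · rw [if_neg hlm]
      have h2 := mul_le_mul_of_nonneg_left (hU.inner_sq l m hlm) (abs_nonneg (c l * c m))
      have h3 : |c l * c m| * (ρ * (‖U l‖ ^ 2 * ‖U m‖ ^ 2)) = ρ * (|w l| * |w m|) := by
        simp only [hw, abs_mul, abs_of_nonneg (sq_nonneg ‖U _‖)]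
        ring
      have h4 := mul_le_mul_of_nonneg_right (neg_abs_le (c l * c m))
        (sq_nonneg (∑ a, U l a * U m a))
      linarith
  have h2 : weightedNormSq U c - ρ * (∑ l, |w l|) ^ 2 ≤ energy U c := by
    rw [energy_eq]
    refine le_trans (le_of_eq ?_) (Finset.sum_le_sum fun l _ => Finset.sum_le_sum fun m _ => h1 l m)
    simp only [Finset.sum_sub_distrib, Finset.sum_ite_eq, Finset.mem_univ, if_true,
      ← Finset.mul_sum]
    rw [weightedNormSq, sq (∑ l, |w l|), Finset.sum_mul]
  have h3 : (∑ l, |w l|) ^ 2 ≤ r * weightedNormSq U c := by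
    have := sq_sum_le_card_mul_sum_sq (s := Finset.univ) (f := fun l => |w l|)
    simpa [weightedNormSq] using this
  have h4 := mul_le_mul_of_nonneg_left h3 hU.nonneg
  have h5 := mul_le_mul_of_nonneg_right hU.small (weightedNormSq_nonneg U c)
  linarith

/-- The entrywise bound is spent on the index `a` only; the index `b` is kept so that summing over
it costs `1` per factor. -/
theorem rowNormSq_le (hU : FactorIncoherence U ρ) (a b : Fin d) :
    rowNormSq U a b ≤ ρ * ∑ l, U l b ^ 2 / ‖U l‖ ^ 2 := by
  rw [Finset.mul_sum]
  refine Finset.sum_le_sum fun l _ => ?_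
  have h0 : 0 < ‖U l‖ ^ 2 := by have := norm_pos_iff.2 (hU.ne_zero l); positivity
  rw [div_pow, mul_pow, ← mul_div_assoc, div_le_div_iff₀ (by positivity) h0]
  have := mul_le_mul_of_nonneg_right (hU.entry l a)
    (mul_nonneg (sq_nonneg (U l b)) h0.le)
  linarith

theorem rowNormSq_le_mul_sq (hU : FactorIncoherence U ρ) (a b : Fin d) :
    rowNormSq U a b ≤ r * ρ ^ 2 := by
  have h : ∑ l, U l b ^ 2 / ‖U l‖ ^ 2 ≤ ∑ _l : Fin r, ρ := by
    refine Finset.sum_le_sum fun l _ => ?_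
    have h0 : 0 < ‖U l‖ ^ 2 := by have := norm_pos_iff.2 (hU.ne_zero l); positivity
    rw [div_le_iff₀ h0]
    exact hU.entry l b
  have := (hU.rowNormSq_le a b).trans (mul_le_mul_of_nonneg_left h hU.nonneg)
  simp only [Finset.sum_const, Finset.card_univ, Fintype.card_fin, nsmul_eq_mul] at this
  linarith

theorem sum_normalized_sq (hU : FactorIncoherence U ρ) :
    ∑ b, (ρ * ∑ l, U l b ^ 2 / ‖U l‖ ^ 2) = r * ρ := by
  rw [← Finset.mul_sum, Finset.sum_comm]
  have : ∀ l, ∑ b, U l b ^ 2 / ‖U l‖ ^ 2 = 1 := by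
    intro l
    have := norm_ne_zero_iff.2 (hU.ne_zero l)
    rw [← Finset.sum_div, ← norm_sq_eq_sum]
    field_simp
  simp [this, mul_comm]

theorem sum_rowNormSq_le (hU : FactorIncoherence U ρ) (a : Fin d) :
    ∑ b, rowNormSq U a b ≤ r * ρ :=
  (Finset.sum_le_sum fun b _ => hU.rowNormSq_le a b).trans hU.sum_normalized_sq.le

theorem sum_rowNormSq_diag_le (hU : FactorIncoherence U ρ) :
    ∑ a, rowNormSq U a a ≤ r * ρ :=
  (Finset.sum_le_sum fun b _ => hU.rowNormSq_le b b).trans hU.sum_normalized_sq.le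

theorem sum_sq_liftedComb_le (hU : FactorIncoherence U ρ) (c : Fin r → ℝ) (a : Fin d) :
    ∑ b, liftedComb U c a b ^ 2 ≤ 2 * (r * ρ) * energy U c := by
  calc ∑ b, liftedComb U c a b ^ 2 ≤ ∑ b, weightedNormSq U c * rowNormSq U a b :=
        Finset.sum_le_sum fun b _ => sq_liftedComb_le U hU.ne_zero c a b
    _ ≤ (2 * energy U c) * (r * ρ) := by
        rw [← Finset.mul_sum]
        exact mul_le_mul (hU.weightedNormSq_le c) (hU.sum_rowNormSq_le a)
          (Finset.sum_nonneg fun _ _ => Finset.sum_nonneg fun _ _ => sq_nonneg _)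
          (by linarith [energy_nonneg U c])
    _ = _ := by ring

theorem sum_sq_liftedComb_diag_le (hU : FactorIncoherence U ρ) (c : Fin r → ℝ) :
    ∑ a, liftedComb U c a a ^ 2 ≤ 2 * (r * ρ) * energy U c := by
  calc ∑ a, liftedComb U c a a ^ 2 ≤ ∑ a, weightedNormSq U c * rowNormSq U a a :=
        Finset.sum_le_sum fun a _ => sq_liftedComb_le U hU.ne_zero c a a
    _ ≤ (2 * energy U c) * (r * ρ) := by
        rw [← Finset.mul_sum]
        exact mul_le_mul (hU.weightedNormSq_le c) hU.sum_rowNormSq_diag_le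
          (Finset.sum_nonneg fun _ _ => Finset.sum_nonneg fun _ _ => sq_nonneg _)
          (by linarith [energy_nonneg U c])
    _ = _ := by ring

theorem sq_liftedComb_le_energy (hU : FactorIncoherence U ρ) (c : Fin r → ℝ) (a b : Fin d) :
    liftedComb U c a b ^ 2 ≤ 2 * (r * ρ ^ 2) * energy U c := by
  calc liftedComb U c a b ^ 2 ≤ weightedNormSq U c * rowNormSq U a b :=
        sq_liftedComb_le U hU.ne_zero c a b
    _ ≤ (2 * energy U c) * (r * ρ ^ 2) :=
        mul_le_mul (hU.weightedNormSq_le c) (hU.rowNormSq_le_mul_sq a b)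
          (Finset.sum_nonneg fun _ _ => sq_nonneg _) (by linarith [energy_nonneg U c])
    _ = _ := by ring

end FactorIncoherence

/-- The sum over the rows `i` of `h` of the energy of that row. -/
noncomputable def totalEnergy (U h : Factors d r) : ℝ := ∑ i, energy U fun l => h l i

theorem totalEnergy_nonneg (U h : Factors d r) : 0 ≤ totalEnergy U h :=
  Finset.sum_nonneg fun _ _ => energy_nonneg _ _

theorem tangentTensor_eq (U h : Factors d r) (i j k : Fin d) :
    tangentTensor U h i j k = liftedComb U (fun l => h l i) j k +
      liftedComb U (fun l => h l j) i k + liftedComb U (fun l => h l k) i j := by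
  simp only [tangentTensor, liftedComb, Finset.sum_add_distrib]

/-- Three terms, each with square at most `2rρ²` times the total energy; `(x + y + z)² ≤ 3(x² + y² +
z²)` gives `18 = 3 · 3 · 2`. -/
theorem FactorIncoherence.sq_symTangent_le {U : Factors d r} {ρ : ℝ}
    (hU : FactorIncoherence U ρ) (h : Factors d r) (s : Triple d) :
    symTangent U h s ^ 2 ≤ 18 * (r * ρ ^ 2) * totalEnergy U h := by
  obtain ⟨i, j, k, rfl⟩ := exists_eq_triple s
  rw [symTangent_triple, tangentTensor_eq]
  have hb : ∀ i a b, liftedComb U (fun l => h l i) a b ^ 2 ≤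
      2 * (r * ρ ^ 2) * totalEnergy U h := fun i a b =>
    (hU.sq_liftedComb_le_energy _ a b).trans <| mul_le_mul_of_nonneg_left
      (Finset.single_le_sum (f := fun i => energy U fun l => h l i)
        (fun _ _ => energy_nonneg _ _) (Finset.mem_univ i)) (by positivity)
  have h1 := hb i j k
  have h2 := hb j i k
  have h3 := hb k i j
  set x := liftedComb U (fun l => h l i) j k
  set y := liftedComb U (fun l => h l j) i k
  set z := liftedComb U (fun l => h l k) i j
  nlinarith [sq_nonneg (x - y), sq_nonneg (y - z), sq_nonneg (x - z)]

/-- The squares contribute `3/6 = 1/2`. A cross term needs two modes with index in `K`, hence lives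
on at most three rows of a lifted matrix, and incoherence leaves only a fraction `2rρ` of the energy
on each row. The constant is `26 = 12/2 + 20`: cross terms, then the diagonal triples. -/
theorem FactorIncoherence.sum_sq_symTangent_le {U : Factors d r} {ρ : ℝ}
    (hU : FactorIncoherence U ρ) (h : Factors d r) {K : Finset (Fin d)} (hK : K.card ≤ 3)
    (hsupp : ∀ l, ∀ i ∉ K, h l i = 0) :
    ∑ s, symTangent U h s ^ 2 ≤ (1 / 2 + 26 * (r * ρ)) * totalEnergy U h := by
  classical
  set g : Fin d → Fin d → Fin d → ℝ := fun i => liftedComb U fun l => h l i with hg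
  have hgc : ∀ i a b, g i a b = g i b a := fun i => liftedComb_comm U _
  have hg0 : ∀ i ∉ K, ∀ a b, g i a b = 0 := fun i hi a b => by
    simp [hg, liftedComb, hsupp _ i hi]
  set χ : Fin d → ℝ := fun j => if j ∈ K then 1 else 0 with hχ
  have hχ0 : ∀ j, 0 ≤ χ j := fun j => by simp only [hχ]; split_ifs <;> norm_num
  -- The product vanishes unless both `i` and `j` lie in `K`, so after AM-GM each square may carry
  -- the indicator of the other index.
  have hcross : ∀ i j a b a' b', 2 * (g i a b * g j a' b') ≤
      χ j * g i a b ^ 2 + χ i * g j a' b' ^ 2 := by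
    intro i j a b a' b'
    by_cases hi : i ∈ K
    · by_cases hj : j ∈ K
      · simp only [hχ, hi, hj, if_true]
        nlinarith [sq_nonneg (g i a b - g j a' b')]
      · rw [hg0 j hj a' b']
        simpa using mul_nonneg (hχ0 j) (sq_nonneg (g i a b))
    · rw [hg0 i hi a b]
      simpa using mul_nonneg (hχ0 i) (sq_nonneg (g j a' b'))
  set F : Fin d → Fin d → Fin d → ℝ := fun i a b => g i a b ^ 2 * (1 + χ a + χ b) with hF
  have hpt : ∀ i j k, symTangent U h (triple i j k) ^ 2 ≤ F i j k + F j i k + F k i j := by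
    intro i j k
    rw [symTangent_triple, tangentTensor_eq]
    change (g i j k + g j i k + g k i j) ^ 2 ≤ _
    simp only [hF]
    linarith [hcross i j j k i k, hcross j k i k i j, hcross i k j k i j]
  have hrow : ∀ i a, ∑ b, g i a b ^ 2 ≤ 2 * (r * ρ) * energy U fun l => h l i := fun i a =>
    hU.sum_sq_liftedComb_le _ a
  have hχs : ∑ a, χ a ≤ 3 := by
    simp only [hχ, Finset.sum_ite_mem, Finset.univ_inter, Finset.sum_const, nsmul_eq_mul, mul_one]
    exact_mod_cast hK
  have hrρ : 0 ≤ r * ρ := mul_nonneg (Nat.cast_nonneg r) hU.nonneg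
  have hZ : ∀ i, ∑ a, ∑ b, g i a b ^ 2 * χ a ≤ 6 * (r * ρ) * energy U fun l => h l i := by
    intro i
    have he := energy_nonneg U fun l => h l i
    calc ∑ a, ∑ b, g i a b ^ 2 * χ a = ∑ a, (∑ b, g i a b ^ 2) * χ a := by
          simp only [Finset.sum_mul]
      _ ≤ ∑ a, (2 * (r * ρ) * energy U fun l => h l i) * χ a :=
          Finset.sum_le_sum fun a _ => mul_le_mul_of_nonneg_right (hrow i a) (hχ0 a)
      _ ≤ (2 * (r * ρ) * energy U fun l => h l i) * 3 := by
          rw [← Finset.mul_sum]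
          exact mul_le_mul_of_nonneg_left hχs (by positivity)
      _ = _ := by ring
  have hZ' : ∀ i, ∑ a, ∑ b, g i a b ^ 2 * χ b ≤ 6 * (r * ρ) * energy U fun l => h l i := by
    intro i
    rw [Finset.sum_comm]
    simpa only [hgc i] using hZ i
  have hFs : ∑ i, ∑ a, ∑ b, F i a b ≤ (1 + 12 * (r * ρ)) * totalEnergy U h := by
    rw [totalEnergy, Finset.mul_sum]
    refine Finset.sum_le_sum fun i _ => ?_
    simp only [hF, mul_add, mul_one, Finset.sum_add_distrib]
    have : ∑ a, ∑ b, g i a b ^ 2 = energy U fun l => h l i := rfl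
    linarith [hZ i, hZ' i]
  have hcube : ∑ i, ∑ j, ∑ k, symTangent U h (triple i j k) ^ 2 ≤
      3 * ∑ i, ∑ a, ∑ b, F i a b := by
    refine (Finset.sum_le_sum fun i _ => Finset.sum_le_sum fun j _ => Finset.sum_le_sum
      fun k _ => hpt i j k).trans (le_of_eq ?_)
    simp only [Finset.sum_add_distrib]
    have e1 : ∑ i, ∑ j, ∑ k, F j i k = ∑ i, ∑ a, ∑ b, F i a b := Finset.sum_comm
    have e2 : ∑ i, ∑ j, ∑ k, F k i j = ∑ i, ∑ a, ∑ b, F i a b := by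
      rw [Finset.sum_congr rfl fun i _ => Finset.sum_comm, Finset.sum_comm]
    rw [e1, e2]
    ring
  have hdiag : ∑ i, ∑ k, symTangent U h (triple i i k) ^ 2 ≤
      20 * (r * ρ) * totalEnergy U h := by
    have hpt' : ∀ i k, symTangent U h (triple i i k) ^ 2 ≤ 8 * g i i k ^ 2 + 2 * g k i i ^ 2 := by
      intro i k
      rw [symTangent_triple, tangentTensor_eq]
      change (g i i k + g i i k + g k i i) ^ 2 ≤ _
      nlinarith [sq_nonneg (2 * g i i k - g k i i)]
    refine (Finset.sum_le_sum fun i _ => Finset.sum_le_sum fun k _ => hpt' i k).trans ?_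
    simp only [Finset.sum_add_distrib, ← Finset.mul_sum]
    have e1 : ∑ i, ∑ k, g i i k ^ 2 ≤ 2 * (r * ρ) * totalEnergy U h := by
      rw [totalEnergy, Finset.mul_sum]
      exact Finset.sum_le_sum fun i _ => hrow i i
    have e2 : ∑ i, ∑ k, g k i i ^ 2 ≤ 2 * (r * ρ) * totalEnergy U h := by
      rw [totalEnergy, Finset.mul_sum, Finset.sum_comm]
      exact Finset.sum_le_sum fun k _ => hU.sum_sq_liftedComb_diag_le _
    linarith
  have := sum_triple_le (φ := fun s => symTangent U h s ^ 2) fun s => sq_nonneg _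
  linarith

end Tangent

/-! ### The least favourable direction -/

section Direction

variable {d r : ℕ}

/-- The Gram matrix of the lifted factors. -/
noncomputable def gram (U : Factors d r) : Matrix (Fin r) (Fin r) ℝ :=
  (liftedFactors U)ᵀ * liftedFactors U

theorem liftedFactors_mulVec (U : Factors d r) (c : Fin r → ℝ) (q : Fin d × Fin d) :
    (liftedFactors U *ᵥ c) q = liftedComb U c q.1 q.2 := by
  simp only [Matrix.mulVec, dotProduct, liftedFactors, Matrix.of_apply, liftedComb]
  exact Finset.sum_congr rfl fun l _ => by ring

theorem dotProduct_gram_mulVec (U : Factors d r) (c : Fin r → ℝ) :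
    c ⬝ᵥ (gram U *ᵥ c) = energy U c := by
  rw [gram, ← Matrix.mulVec_mulVec, Matrix.dotProduct_mulVec, Matrix.vecMul_transpose, energy,
    ← Fintype.sum_prod_type' (f := fun a b => liftedComb U c a b ^ 2)]
  exact Finset.sum_congr rfl fun q _ => by rw [liftedFactors_mulVec, sq]

theorem FactorIncoherence.isUnit_gram {U : Factors d r} {ρ : ℝ} (hU : FactorIncoherence U ρ) :
    IsUnit (gram U) := by
  rw [← Matrix.mulVec_injective_iff_isUnit]
  refine (injective_iff_map_eq_zero (gram U).mulVecLin).2 fun c hc => ?_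
  have h1 : energy U c = 0 := by
    rw [← dotProduct_gram_mulVec]
    rw [Matrix.mulVecLin_apply] at hc
    rw [hc, dotProduct_zero]
  have h2 : weightedNormSq U c = 0 :=
    le_antisymm (by linarith [hU.weightedNormSq_le c]) (weightedNormSq_nonneg U c)
  ext l
  have h3 := (Finset.sum_eq_zero_iff_of_nonneg fun l _ => sq_nonneg _).1 h2 l (Finset.mem_univ l)
  have := norm_ne_zero_iff.2 (hU.ne_zero l)
  simpa [this] using h3

/-- The direction whose `i`-th row is `(ŨᵀŨ)⁻¹ w_i`. -/
noncomputable def optimalDirection (U : Factors d r) (w : Fin d → Fin r → ℝ) : Factors d r :=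
  fun l => WithLp.toLp 2 fun i => ((gram U)⁻¹ *ᵥ w i) l

/-- The quadratic form of `(ŨᵀŨ)⁻¹`. -/
noncomputable def invGramForm (U : Factors d r) (x : Fin r → ℝ) : ℝ := x ⬝ᵥ ((gram U)⁻¹ *ᵥ x)

theorem invGramForm_smul (U : Factors d r) (a : ℝ) (x : Fin r → ℝ) :
    invGramForm U (a • x) = a ^ 2 * invGramForm U x := by
  simp only [invGramForm, Matrix.mulVec_smul, dotProduct_smul, smul_dotProduct, smul_eq_mul]
  ring

theorem invGramForm_zero (U : Factors d r) : invGramForm U 0 = 0 := by simp [invGramForm]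

theorem optimalDirection_row (U : Factors d r) (w : Fin d → Fin r → ℝ) (i : Fin d) :
    (fun l => optimalDirection U w l i) = (gram U)⁻¹ *ᵥ w i := rfl

/-- The same number is the derivative of the target along this direction
(`optimalDirection_factorGradient`, `tangentTensor_optimalDirection`); this is the equality case of
Cauchy–Schwarz in the Gram form. -/
theorem FactorIncoherence.totalEnergy_optimalDirection {U : Factors d r} {ρ : ℝ}
    (hU : FactorIncoherence U ρ) (w : Fin d → Fin r → ℝ) :
    totalEnergy U (optimalDirection U w) = ∑ i, invGramForm U (w i) := by
  refine Finset.sum_congr rfl fun i _ => ?_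
  rw [optimalDirection_row, ← dotProduct_gram_mulVec, Matrix.mulVec_mulVec,
    Matrix.mul_nonsing_inv _ ((Matrix.isUnit_iff_isUnit_det _).1 hU.isUnit_gram),
    Matrix.one_mulVec, invGramForm, dotProduct_comm]

/-- For homoscedastic noise the middle of the sandwich is a multiple of the Gram matrix and cancels
one inverse. -/
theorem FactorIncoherence.factorCov_eq {U : Factors d r} {ρ : ℝ}
    (hU : FactorIncoherence U ρ) (p σ : ℝ) (k : Fin d) :
    factorCov p (fun _ _ _ => σ ^ 2) U k = (2 / p * σ ^ 2) • (gram U)⁻¹ := by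
  have h1 : noiseSlice (fun _ _ _ => σ ^ 2 : Tensor d) k =
      σ ^ 2 • (1 : Matrix (Fin d × Fin d) (Fin d × Fin d) ℝ) := by
    rw [noiseSlice, Matrix.smul_one_eq_diagonal]
  rw [factorCov, h1, mul_smul, Matrix.mul_smul, Matrix.mul_one, Matrix.smul_mul, Matrix.smul_mul,
    ← gram, Matrix.mul_assoc (gram U)⁻¹, ← gram,
    Matrix.nonsing_inv_mul _ ((Matrix.isUnit_iff_isUnit_det _).1 hU.isUnit_gram), Matrix.one_mul]

/-- The gradient in the rows of the factors of the `(l, k)` entry of the factors. -/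
noncomputable def factorGradient (l : Fin r) (k : Fin d) (i : Fin d) : Fin r → ℝ :=
  if i = k then Pi.single l 1 else 0

/-- The gradient in the rows of the factors of the `(i, j, k)` entry of the tensor. -/
noncomputable def entryGradient (U : Factors d r) (i j k : Fin d) (a : Fin d) : Fin r → ℝ :=
  (if a = i then liftedFactors U (j, k) else 0) + (if a = j then liftedFactors U (i, k) else 0) +
    (if a = k then liftedFactors U (i, j) else 0)

theorem optimalDirection_eq_zero (U : Factors d r) {w : Fin d → Fin r → ℝ} {i : Fin d}
    (hw : w i = 0) (l : Fin r) : optimalDirection U w l i = 0 := by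
  simp [optimalDirection, hw]

theorem factorGradient_eq_zero (l : Fin r) (k : Fin d) {i : Fin d}
    (hi : i ∉ ({k} : Finset (Fin d))) :
    factorGradient l k i = 0 := by
  rw [Finset.mem_singleton] at hi
  simp [factorGradient, hi]

theorem entryGradient_eq_zero (U : Factors d r) (i j k : Fin d) {a : Fin d}
    (ha : a ∉ ({i, j, k} : Finset (Fin d))) : entryGradient U i j k a = 0 := by
  simp only [Finset.mem_insert, Finset.mem_singleton, not_or] at ha
  simp [entryGradient, ha]

theorem sum_invGramForm_factorGradient (U : Factors d r) (l : Fin r) (k : Fin d) :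
    ∑ i, invGramForm U (factorGradient l k i) = (gram U)⁻¹ l l := by
  rw [Finset.sum_eq_single k]
  · simp [factorGradient, invGramForm]
  · intro i _ hi
    simp [factorGradient, hi, invGramForm_zero]
  · simp

theorem optimalDirection_factorGradient (U : Factors d r) (l : Fin r) (k : Fin d) :
    optimalDirection U (factorGradient l k) l k = ∑ i, invGramForm U (factorGradient l k i) := by
  rw [sum_invGramForm_factorGradient]
  simp [optimalDirection, factorGradient]

theorem liftedComb_eq_dotProduct (U : Factors d r) (c : Fin r → ℝ) (a b : Fin d) :
    liftedComb U c a b = liftedFactors U (a, b) ⬝ᵥ c :=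
  (liftedFactors_mulVec U c (a, b)).symm

theorem tangentTensor_optimalDirection (U : Factors d r) (i j k : Fin d) :
    tangentTensor U (optimalDirection U (entryGradient U i j k)) i j k =
      ∑ a, invGramForm U (entryGradient U i j k a) := by
  rw [tangentTensor_eq]
  simp only [liftedComb_eq_dotProduct, optimalDirection_row, invGramForm]
  have h : ∀ a x, entryGradient U i j k a ⬝ᵥ x =
      (if a = i then liftedFactors U (j, k) ⬝ᵥ x else 0) +
      (if a = j then liftedFactors U (i, k) ⬝ᵥ x else 0) +
      (if a = k then liftedFactors U (i, j) ⬝ᵥ x else 0) := by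
    intro a x
    rw [entryGradient, add_dotProduct, add_dotProduct]
    congr 2 <;> split_ifs <;> simp
  simp only [h, Finset.sum_add_distrib, Finset.sum_ite_eq', Finset.mem_univ, if_true]

theorem liftedFactors_swap (U : Factors d r) (a b : Fin d) :
    liftedFactors U (a, b) = liftedFactors U (b, a) := by
  ext l
  simp only [liftedFactors, Matrix.of_apply]
  ring

theorem FactorIncoherence.rowForm_eq {U : Factors d r} {ρ : ℝ}
    (hU : FactorIncoherence U ρ) (p σ : ℝ) (a b c : Fin d) :
    rowForm p (fun _ _ _ => σ ^ 2) U a b c =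
      2 / p * σ ^ 2 * invGramForm U (liftedFactors U (a, b)) := by
  rw [rowForm, hU.factorCov_eq, Matrix.smul_mulVec, dotProduct_smul, smul_eq_mul, invGramForm]

theorem sum_invGramForm_two (U : Factors d r) {i k : Fin d} (hik : i ≠ k)
    {w : Fin d → Fin r → ℝ} (hw : ∀ a, a ≠ i → a ≠ k → w a = 0) :
    ∑ a, invGramForm U (w a) = invGramForm U (w i) + invGramForm U (w k) := by
  rw [Finset.sum_eq_add i k hik (fun a _ ha => by rw [hw a ha.1 ha.2, invGramForm_zero])] <;> simp

/-- When indices coincide, their gradients fall in the same row and add before the quadratic form is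
applied; this produces the factors `4 = 2²` and `9 = 3²`. -/
theorem FactorIncoherence.entryVar_eq {U : Factors d r} {ρ : ℝ}
    (hU : FactorIncoherence U ρ) (p σ : ℝ) (i j k : Fin d) :
    entryVar p (fun _ _ _ => σ ^ 2) U i j k =
      2 / p * σ ^ 2 * ∑ a, invGramForm U (entryGradient U i j k a) := by
  have hdouble : ∀ x : Fin r → ℝ, invGramForm U (x + x) = 4 * invGramForm U x := fun x => by
    rw [← two_smul ℝ, invGramForm_smul]
    norm_num
  simp only [entryVar, hU.rowForm_eq]
  split_ifs with hij hjk hjk hik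
  · subst hij hjk
    rw [Finset.sum_eq_single i (fun a _ ha => by simp [entryGradient, ha, invGramForm_zero])
      (by simp)]
    have : entryGradient U i i i i = (3 : ℝ) • liftedFactors U (i, i) := by
      simp only [entryGradient, if_true]
      module
    rw [this, invGramForm_smul]
    ring
  · subst hij
    rw [sum_invGramForm_two U hjk fun a h1 h2 => by simp [entryGradient, h1, h2]]
    simp only [entryGradient, if_true, if_neg hjk, if_neg (Ne.symm hjk), _root_.add_zero,
      _root_.zero_add, hdouble]
    ring
  · subst hjk
    rw [sum_invGramForm_two U hij fun a h1 h2 => by simp [entryGradient, h1, h2]]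
    simp only [entryGradient, if_true, if_neg hij, if_neg (Ne.symm hij), _root_.add_zero,
      _root_.zero_add, hdouble, liftedFactors_swap U j i]
    ring
  · subst hik
    rw [sum_invGramForm_two U hij fun a h1 h2 => by simp [entryGradient, h1, h2]]
    simp only [entryGradient, if_true, if_neg hij, if_neg (Ne.symm hij), _root_.add_zero,
      _root_.zero_add, hdouble, liftedFactors_swap U j i]
    ring
  · have h : ∀ a, invGramForm U (entryGradient U i j k a) =
        (if a = i then invGramForm U (liftedFactors U (j, k)) else 0) +
        (if a = j then invGramForm U (liftedFactors U (i, k)) else 0) +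
        (if a = k then invGramForm U (liftedFactors U (i, j)) else 0) := by
      intro a
      by_cases h1 : a = i
      · subst h1
        simp [entryGradient, hij, hik]
      by_cases h2 : a = j
      · subst h2
        simp [entryGradient, h1, hjk]
      by_cases h3 : a = k
      · subst h3
        simp [entryGradient, h1, h2]
      · simp [entryGradient, h1, h2, h3, invGramForm_zero]
    simp only [h, Finset.sum_add_distrib, Finset.sum_ite_eq', Finset.mem_univ, if_true]
    ring

end Direction

/-! ### Concentration of the information and the lower bounds -/

section LowerBound

variable {d r : ℕ}

instance isProbabilityMeasure_samplingLaw (p : unitInterval) :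
    IsProbabilityMeasure (samplingLaw d p) := by
  unfold samplingLaw
  infer_instance

/-- Summing the entrywise bound over one factor gives `1 ≤ dρ`, to be compared with `rρ ≤ 1/2`. The
union bound uses this to count the targets. -/
theorem FactorIncoherence.rank_le {U : Factors d r} {ρ : ℝ} (hU : FactorIncoherence U ρ) :
    r ≤ d := by
  rcases Nat.eq_zero_or_pos r with rfl | hr
  · exact Nat.zero_le d
  have h0 : 0 < ‖U ⟨0, hr⟩‖ ^ 2 := by have := norm_pos_iff.2 (hU.ne_zero ⟨0, hr⟩); positivity
  have h1 : ‖U ⟨0, hr⟩‖ ^ 2 ≤ ∑ _a : Fin d, ρ * ‖U ⟨0, hr⟩‖ ^ 2 := by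
    conv_lhs => rw [norm_sq_eq_sum]
    exact Finset.sum_le_sum fun a _ => hU.entry _ a
  rw [Finset.sum_const, Finset.card_univ, Fintype.card_fin, nsmul_eq_mul, ← mul_assoc] at h1
  have h2 : 1 ≤ d * ρ := by
    by_contra! h
    have := mul_lt_mul_of_pos_right h h0
    linarith
  have h3 := mul_le_mul_of_nonneg_left h2 (Nat.cast_nonneg (α := ℝ) r)
  have h4 := mul_le_mul_of_nonneg_left hU.small (Nat.cast_nonneg (α := ℝ) d)
  have h5 : (r : ℝ) ≤ d := by
    have := Nat.cast_nonneg (α := ℝ) d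
    linarith
  exact_mod_cast h5

/-- The upper bound for the information in the direction `h` that holds with high probability. -/
noncomputable def informationBound (p δ ρ : ℝ) (U h : Factors d r) : ℝ :=
  p * ((1 + δ) * ((1 / 2 + 26 * (r * ρ)) * totalEnergy U h))

/-- Chernoff with `B = 18 rρ² W`, `m ≥ W/2` and `δ² = 1 / log d`: the exponent is at least `14 log
d` once `p ≥ 2016 rρ² log² d`, where `2016 = 14 · 4 · 18 · 2`. -/
theorem FactorIncoherence.real_informationBound_lt_le {U : Factors d r} {ρ : ℝ}
    (hU : FactorIncoherence U ρ) {p : unitInterval} (hd : 1 ≤ Real.log d)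
    (hp : 2016 * (r * ρ ^ 2 * Real.log d ^ 2) ≤ p) (h : Factors d r) {K : Finset (Fin d)}
    (hK : K.card ≤ 3) (hsupp : ∀ l, ∀ i ∉ K, h l i = 0) :
    (samplingLaw d p).real
      {S | informationBound p (1 / √(Real.log d)) ρ U h < information S U h} ≤
      1 / (d : ℝ) ^ 14 := by
  set L := Real.log d with hL
  have hL0 : 0 < L := by linarith
  have hs1 : 1 ≤ √L := Real.one_le_sqrt.2 hd
  have hδ1 : 1 / √L ≤ 1 := by rw [div_le_one (by linarith)]; exact hs1
  have hW := totalEnergy_nonneg U h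
  have hrρ : 0 ≤ r * ρ := mul_nonneg (Nat.cast_nonneg r) hU.nonneg
  have hm := hU.sum_sq_symTangent_le h hK hsupp
  -- The Chernoff bound needs `B > 0`; if `B = 0`, the tangent vanishes and the bad event is empty.
  rcases (by positivity : 0 ≤ 18 * (r * ρ ^ 2) * totalEnergy U h).eq_or_lt with hB | hB
  · have hz : ∀ s, symTangent U h s ^ 2 = 0 := fun s =>
      le_antisymm ((hU.sq_symTangent_le h s).trans hB.ge) (sq_nonneg _)
    have hempty : {S | informationBound p (1 / √L) ρ U h < information S U h} = ∅ := by
      refine Set.eq_empty_of_forall_notMem fun S hS => ?_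
      rw [Set.mem_ofPred_eq] at hS
      have h1 : information S U h = 0 := by simp [information, hz]
      have h2 : 0 ≤ informationBound p (1 / √L) ρ U h := by
        have := p.2.1
        unfold informationBound
        positivity
      linarith
    rw [hempty, measureReal_empty]
    positivity
  · refine (setBernoulli_real_lt_sum_indicator_le p hB (fun s => sq_nonneg _)
      (fun s => hU.sq_symTangent_le h s) hm (by positivity) (by linarith)).trans ?_
    have hd0 : (0 : ℝ) < d := by
      by_contra! hd0
      have : (d : ℝ) = 0 := le_antisymm hd0 (Nat.cast_nonneg d)
      rw [hL, this, Real.log_zero] at hL0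
      exact lt_irrefl _ hL0
    have h14 : 1 / (d : ℝ) ^ 14 = Real.exp (-(14 * L)) := by
      rw [Real.exp_neg, hL, one_div, ← Real.exp_log (pow_pos hd0 14), Real.log_pow]
      norm_num
    rw [h14, Real.exp_le_exp, neg_le_neg_iff, div_pow, one_pow, Real.sq_sqrt hL0.le,
      le_div_iff₀ (by linarith)]
    set W := totalEnergy U h
    have h1 : 1 / 2 * W ≤ (1 / 2 + 26 * (r * ρ)) * W :=
      mul_le_mul_of_nonneg_right (by linarith) hW
    have h2 := mul_le_mul hp h1 (by positivity) p.2.1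
    calc 14 * L * (4 * (18 * (r * ρ ^ 2) * W))
        = 2016 * (r * ρ ^ 2 * L ^ 2) * (1 / 2 * W) * (1 / L) := by field_simp; ring
      _ ≤ _ := mul_le_mul_of_nonneg_right h2 (by positivity)

/-- For a direction whose derivative equals its energy `W`, Cramér–Rao reads `σ² W² / J` with `J =
(p/2)(1 + δ)(1 + b) W` and `b = 52 rρ`, and `(1 - δ - b)(1 + δ)(1 + b) ≤ 1`. -/
theorem IsUnbiasedAt.ofReal_totalEnergy_le_evariance {σ : ℝ≥0} (hσ : 0 < σ) {S : Set (Triple d)}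
    {U : Factors d r} {f : Tensor d → ℝ} {θ : Factors d r → ℝ} (hf : IsUnbiasedAt σ S U f θ)
    {h : Factors d r} (hθ : HasDerivAt (fun t : ℝ => θ (U + t • h)) (totalEnergy U h) 0)
    {p δ ρ ε : ℝ} (hp : 0 ≤ p) (hδ : 0 ≤ δ) (hρ : 0 ≤ ρ) (hε : δ + 52 * (r * ρ) ≤ ε)
    (hinfo : information S U h ≤ informationBound p δ ρ U h) :
    ENNReal.ofReal ((1 - ε) * (2 / p * (σ : ℝ) ^ 2 * totalEnergy U h)) ≤
      evariance f (obsLaw σ S U) := by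
  have hW := totalEnergy_nonneg U h
  rcases hW.eq_or_lt with hW0 | hW0
  · simp [← hW0]
  -- For `p = 0` the convention `2 / 0 = 0` makes the claimed bound zero.
  rcases hp.eq_or_lt with hp0 | hp0
  · simp [← hp0]
  have hrρ : 0 ≤ r * ρ := mul_nonneg (Nat.cast_nonneg r) hρ
  set b := 52 * (r * ρ) with hb
  have hb0 : 0 ≤ b := by positivity
  have hJ : informationBound p δ ρ U h = p / 2 * ((1 + δ) * (1 + b)) * totalEnergy U h := by
    rw [informationBound, hb]
    ring
  have hJ0 : 0 < informationBound p δ ρ U h := by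
    rw [hJ]
    positivity
  refine le_trans (ENNReal.ofReal_le_ofReal ?_) (hf.ofReal_le_evariance hσ hθ hJ0 hinfo)
  rw [le_div_iff₀ hJ0, hJ]
  have h1 : (1 - ε) * ((1 + δ) * (1 + b)) ≤ 1 := by
    have h2 : (1 - ε) * ((1 + δ) * (1 + b)) ≤ (1 - (δ + b)) * ((1 + δ) * (1 + b)) :=
      mul_le_mul_of_nonneg_right (by linarith) (by positivity)
    nlinarith [mul_nonneg hδ hb0, mul_nonneg (mul_nonneg hδ hb0) (add_nonneg hδ hb0),
      sq_nonneg δ, sq_nonneg b]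
  have h3 := mul_le_mul_of_nonneg_right h1
    (by positivity : 0 ≤ (σ : ℝ) ^ 2 * totalEnergy U h ^ 2)
  calc (1 - ε) * (2 / p * (σ : ℝ) ^ 2 * totalEnergy U h) *
        (p / 2 * ((1 + δ) * (1 + b)) * totalEnergy U h)
      = (1 - ε) * ((1 + δ) * (1 + b)) * ((σ : ℝ) ^ 2 * totalEnergy U h ^ 2) := by
        field_simp
    _ ≤ _ := by linarith

/-- The gradients of the entries of the factors and of the tensor. -/
noncomputable def targetGradient (U : Factors d r) :
    Fin r × Fin d ⊕ Fin d × Fin d × Fin d → Fin d → Fin r → ℝ :=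
  Sum.elim (fun x => factorGradient x.1 x.2) fun x => entryGradient U x.1 x.2.1 x.2.2

theorem exists_support_targetGradient (U : Factors d r)
    (x : Fin r × Fin d ⊕ Fin d × Fin d × Fin d) :
    ∃ K : Finset (Fin d), K.card ≤ 3 ∧
      ∀ l, ∀ i ∉ K, optimalDirection U (targetGradient U x) l i = 0 := by
  classical
  rcases x with ⟨l, k⟩ | ⟨i, j, k⟩
  · exact ⟨{k}, by simp, fun l' i hi =>
      optimalDirection_eq_zero U (factorGradient_eq_zero l k hi) l'⟩
  · exact ⟨{i, j, k}, Finset.card_le_three, fun l' a ha =>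
      optimalDirection_eq_zero U (entryGradient_eq_zero U i j k ha) l'⟩

theorem FactorIncoherence.mem_lowerBoundEvent {U : Factors d r} {ρ : ℝ}
    (hU : FactorIncoherence U ρ) {σ : ℝ≥0} (hσ : 0 < σ) {p δ ε : ℝ} (hp : 0 ≤ p) (hδ : 0 ≤ δ)
    (hε : δ + 52 * (r * ρ) ≤ ε) {S : Set (Triple d)}
    (hS : ∀ x, information S U (optimalDirection U (targetGradient U x)) ≤
      informationBound p δ ρ U (optimalDirection U (targetGradient U x))) :
    S ∈ lowerBoundEvent p σ U ε := by
  refine ⟨fun l k uhat hu => ?_, fun i j k That hT => ?_⟩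
  · have hE := hU.totalEnergy_optimalDirection (factorGradient l k)
    have := hu.ofReal_totalEnergy_le_evariance hσ (h := optimalDirection U (factorGradient l k))
      (by rw [hE, ← optimalDirection_factorGradient]; exact hasDerivAt_entry U _ l k)
      hp hδ hU.nonneg hε (hS (Sum.inl (l, k)))
    rw [hE, sum_invGramForm_factorGradient] at this
    rw [hU.factorCov_eq, Matrix.smul_apply, smul_eq_mul]
    exact this
  · have hE := hU.totalEnergy_optimalDirection (entryGradient U i j k)
    have := hT.ofReal_totalEnergy_le_evariance hσ (h := optimalDirection U (entryGradient U i j k))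
      (by rw [hE, ← tangentTensor_optimalDirection]; exact hasDerivAt_cpTensor U _ i j k)
      hp hδ hU.nonneg hε (hS (Sum.inr (i, j, k)))
    rw [hU.entryVar_eq]
    rwa [hE] at this

/-- Union bound over the `rd + d³ ≤ 2d³` targets. The directions depend on `U` and the target but
not on `S` or the estimator, so one event serves all estimators at once. -/
theorem FactorIncoherence.le_real_lowerBoundEvent {U : Factors d r} {ρ : ℝ}
    (hU : FactorIncoherence U ρ) {σ : ℝ≥0} (hσ : 0 < σ) {p : unitInterval}
    (hd : 1 ≤ Real.log d) (hp : 2016 * (r * ρ ^ 2 * Real.log d ^ 2) ≤ p) {ε : ℝ}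
    (hε : 1 / √(Real.log d) + 52 * (r * ρ) ≤ ε) :
    1 - 2 / (d : ℝ) ^ 10 ≤ (samplingLaw d p).real (lowerBoundEvent p σ U ε) := by
  set bad : (Fin r × Fin d ⊕ Fin d × Fin d × Fin d) → Set (Set (Triple d)) := fun x =>
    {S | informationBound p (1 / √(Real.log d)) ρ U (optimalDirection U (targetGradient U x)) <
      information S U (optimalDirection U (targetGradient U x))} with hbad
  have hsub : (lowerBoundEvent p σ U ε)ᶜ ⊆ ⋃ x, bad x := by
    intro S hS
    by_contra hS'
    refine hS (hU.mem_lowerBoundEvent hσ p.2.1 (by positivity) hε fun x => ?_)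
    by_contra! hx
    exact hS' (Set.mem_iUnion.2 ⟨x, hx⟩)
  have hd0 : (0 : ℝ) < d := by
    by_contra! hd0
    have : (d : ℝ) = 0 := le_antisymm hd0 (Nat.cast_nonneg d)
    rw [this, Real.log_zero] at hd
    linarith
  have hd1 : (1 : ℝ) ≤ d := by exact_mod_cast Nat.one_le_iff_ne_zero.2 (by rintro rfl; simp at hd0)
  have hbound : (samplingLaw d p).real (lowerBoundEvent p σ U ε)ᶜ ≤ 2 / (d : ℝ) ^ 10 := by
    calc _ ≤ (samplingLaw d p).real (⋃ x, bad x) := measureReal_mono hsub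
      _ ≤ ∑ x, (samplingLaw d p).real (bad x) := measureReal_iUnion_fintype_le bad
      _ ≤ ∑ _x : Fin r × Fin d ⊕ Fin d × Fin d × Fin d, 1 / (d : ℝ) ^ 14 := by
          refine Finset.sum_le_sum fun x _ => ?_
          obtain ⟨K, hK, hsupp⟩ := exists_support_targetGradient U x
          exact hU.real_informationBound_lt_le hd hp _ hK hsupp
      _ = ((r : ℝ) * d + d * (d * d)) * (1 / (d : ℝ) ^ 14) := by
          simp [Finset.sum_const, Fintype.card_sum]
      _ ≤ ((d : ℝ) * (d * d) + d * (d * d)) * (1 / (d : ℝ) ^ 14) := by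
          have hr : (r : ℝ) ≤ d := by exact_mod_cast hU.rank_le
          have : (r : ℝ) * d ≤ d * (d * d) := by
            have h1 := mul_le_mul_of_nonneg_right hr hd0.le
            have h2 := mul_le_mul_of_nonneg_left hd1 (mul_nonneg hd0.le hd0.le)
            linarith
          gcongr
      _ = 2 / (d : ℝ) ^ 10 * (1 / d) := by field_simp; ring
      _ ≤ 2 / (d : ℝ) ^ 10 := mul_le_of_le_one_right (by positivity)
          ((div_le_one hd0).2 hd1)
  have hmeas : MeasurableSet (lowerBoundEvent p σ U ε) := (Set.toFinite _).measurableSet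
  have := probReal_compl_eq_one_sub (μ := samplingLaw d p) hmeas
  linarith

end LowerBound

/-! ### Reduction to pairwise incoherence, and small dimensions -/

section Incoherence

variable {d r : ℕ}

theorem IsIncoherent.factorIncoherence {U : Factors d r} {μ₀ μ₁ μ₂ K μ : ℝ}
    (hU : IsIncoherent U μ₀ μ₁ μ₂ K) (h₁ : μ₁ ≤ μ) (h₂ : μ₂ ≤ μ) (hμ : 0 ≤ μ)
    (hsmall : r * (μ / d) ≤ 1 / 2) : FactorIncoherence U (μ / d) where
  nonneg := by positivity
  ne_zero := hU.factor_ne_zero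
  entry l i := by
    have h := (hU.factor_entry l i).trans (mul_le_mul_of_nonneg_right
      (Real.sqrt_le_sqrt (by gcongr : μ₁ / (d : ℝ) ≤ μ / d)) (norm_nonneg _))
    have := pow_le_pow_left₀ (abs_nonneg _) h 2
    rwa [sq_abs, mul_pow, Real.sq_sqrt (by positivity)] at this
  inner_sq l m hlm := by
    have h := (hU.factor_inner l m hlm).trans (mul_le_mul_of_nonneg_right
      (mul_le_mul_of_nonneg_right (Real.sqrt_le_sqrt (by gcongr : μ₂ / (d : ℝ) ≤ μ / d))
        (norm_nonneg (U l))) (norm_nonneg (U m)))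
    have := pow_le_pow_left₀ (abs_nonneg _) h 2
    rw [sq_abs, mul_pow, mul_pow, Real.sq_sqrt (by positivity), mul_assoc] at this
    have hinner : inner ℝ (U l) (U m) = ∑ a, U l a * U m a := by
      rw [PiLp.inner_apply]
      exact Finset.sum_congr rfl fun a _ => by simp [mul_comm]
    rwa [hinner] at this
  small := hsmall

/-- The term `N ^ 10` makes the left side nonpositive for `0 < d < N`, so the estimate is needed
only for large `d`. -/
theorem one_sub_div_le_real_lowerBoundEvent {N : ℕ} {p : unitInterval} {σ : ℝ≥0}
    {U : Factors d r} {ε : ℝ} (h : N ≤ d →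
      1 - 2 / (d : ℝ) ^ 10 ≤ (samplingLaw d p).real (lowerBoundEvent p σ U ε)) :
    1 - (2 + (N : ℝ) ^ 10) / (d : ℝ) ^ 10 ≤
      (samplingLaw d p).real (lowerBoundEvent p σ U ε) := by
  -- At `d = 0` the division by zero makes the left side `1`; the event is then everything because
  -- there are no indices.
  rcases Nat.eq_zero_or_pos d with rfl | hd
  · have : lowerBoundEvent p σ U ε = Set.univ := by
      refine Set.eq_univ_of_forall fun S => ⟨fun _ k => k.elim0, fun i => i.elim0⟩
    rw [this, probReal_univ]
    simp
  have hd0 : (0 : ℝ) < d := by exact_mod_cast hd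
  by_cases hN : N ≤ d
  · refine le_trans ?_ (h hN)
    gcongr
    linarith [pow_nonneg (Nat.cast_nonneg (α := ℝ) N) 10]
  · refine le_trans ?_ measureReal_nonneg
    rw [sub_nonpos, le_div_iff₀ (by positivity), one_mul]
    have : (d : ℝ) ^ 10 ≤ (N : ℝ) ^ 10 :=
      pow_le_pow_left₀ hd0.le (by exact_mod_cast (not_le.1 hN).le) 10
    linarith

theorem tendsto_log_natCast : Tendsto (fun d : ℕ => Real.log d) atTop atTop :=
  Real.tendsto_log_atTop.comp tendsto_natCast_atTop_atTop

theorem tendsto_one_div_sqrt_log : Tendsto (fun d : ℕ => 1 / √(Real.log d)) atTop (𝓝 0) :=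
  tendsto_const_nhds.div_atTop (Real.tendsto_sqrt_atTop.comp tendsto_log_natCast)

end Incoherence

end TensorCompletion

/-! ### Choice of the constants -/

open TensorCompletion in
theorem theorem5 :
    -- bounded incoherence, condition number and rank
    (∀ (M K : ℝ) (R : ℕ), ∃ c₆ : ℝ, 0 < c₆ ∧ ∃ (C : ℝ) (ε : ℕ → ℝ), Tendsto ε atTop (𝓝 0) ∧
      ∀ (d r : ℕ) (U : Factors d r) (μ₀ μ₁ μ₂ : ℝ) (σ : ℝ≥0) (p : unitInterval),
        IsIncoherent U μ₀ μ₁ μ₂ K → max μ₀ (max μ₁ μ₂) ≤ M → r ≤ R → 0 < σ →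
        c₆ * Real.log d ^ 2 / (d : ℝ) ^ 2 ≤ p →
        1 - C / (d : ℝ) ^ 10 ≤ (samplingLaw d p).real (lowerBoundEvent p σ U (ε d))) ∧
    -- general incoherence and rank
    (∀ K : ℝ, ∃ c₆ c₇ : ℝ, 0 < c₆ ∧ 0 < c₇ ∧ ∃ (C : ℝ) (ε : ℕ → ℝ), Tendsto ε atTop (𝓝 0) ∧
      ∀ (d r : ℕ) (U : Factors d r) (μ₀ μ₁ μ₂ μ : ℝ) (σ : ℝ≥0) (p : unitInterval),
        IsIncoherent U μ₀ μ₁ μ₂ K → μ = max μ₀ (max μ₁ μ₂) → 0 < σ →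
        c₆ * (μ ^ 2 * r * Real.log d ^ 2) / (d : ℝ) ^ 2 ≤ p →
        (r : ℝ) ≤ c₇ * √(d / (μ * Real.log d)) →
        1 - C / (d : ℝ) ^ 10 ≤ (samplingLaw d p).real (lowerBoundEvent p σ U (ε d))) := by
  refine ⟨fun M K R => ?_, fun K => ?_⟩
  · set M' := max M 0 with hM'
    have hM0 : 0 ≤ M' := le_max_right _ _
    -- The two thresholds secure `log d ≥ 1` and `rρ ≤ R M' / d ≤ 1/2`.
    obtain ⟨N, hN⟩ := eventually_atTop.1 ((tendsto_log_natCast.eventually_ge_atTop 1).and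
      (tendsto_natCast_atTop_atTop.eventually_ge_atTop (2 * (R * M'))))
    -- The summand `1` keeps `c₆` positive when `R * M' = 0`.
    refine ⟨2016 * (R * M' ^ 2) + 1, by positivity, 2 + (N : ℝ) ^ 10,
      fun d => 1 / √(Real.log d) + 52 * (R * M' / d), ?_, ?_⟩
    · simpa using tendsto_one_div_sqrt_log.add
        ((tendsto_const_div_atTop_nhds_zero_nat (R * M' : ℝ)).const_mul 52)
    intro d r U μ₀ μ₁ μ₂ σ p hU hM hr hσ hp
    refine one_sub_div_le_real_lowerBoundEvent fun hd => ?_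
    obtain ⟨hlog, hlarge⟩ := hN d hd
    have hd0 : (0 : ℝ) < d := Nat.cast_pos.2 (Nat.pos_of_ne_zero (by rintro rfl; norm_num at hlog))
    have hrR : (r : ℝ) ≤ R := by exact_mod_cast hr
    have hrρ : r * (M' / d) ≤ R * M' / d := by
      rw [mul_div_assoc]
      gcongr
    have h₁ : μ₁ ≤ M' := by simp only [max_le_iff] at hM; exact hM.2.1.trans (le_max_left _ _)
    have h₂ : μ₂ ≤ M' := by simp only [max_le_iff] at hM; exact hM.2.2.trans (le_max_left _ _)
    have hF := hU.factorIncoherence h₁ h₂ hM0 (hrρ.trans (by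
      rw [div_le_iff₀ hd0]
      linarith))
    refine hF.le_real_lowerBoundEvent hσ hlog (le_trans ?_ hp) (by beta_reduce; linarith)
    rw [le_div_iff₀ (by positivity)]
    calc 2016 * (r * (M' / d) ^ 2 * Real.log d ^ 2) * (d : ℝ) ^ 2
        = 2016 * (r * M' ^ 2) * Real.log d ^ 2 := by field_simp
      _ ≤ (2016 * (R * M' ^ 2) + 1) * Real.log d ^ 2 := by
          refine mul_le_mul_of_nonneg_right ?_ (sq_nonneg _)
          have := mul_le_mul_of_nonneg_right hrR (sq_nonneg M')
          linarith
  -- The rank condition will give `rρ ≤ 1 / log d`, which tends to zero and is at most `1/2` once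
  -- `log d ≥ 2`.
  · obtain ⟨N, hN⟩ := eventually_atTop.1 (tendsto_log_natCast.eventually_ge_atTop 2)
    refine ⟨2016, 1, by norm_num, one_pos, 2 + (N : ℝ) ^ 10,
      fun d => 1 / √(Real.log d) + 52 * (1 / Real.log d), ?_, ?_⟩
    · simpa using tendsto_one_div_sqrt_log.add
        ((tendsto_const_nhds (x := (1 : ℝ)).div_atTop tendsto_log_natCast).const_mul 52)
    intro d r U μ₀ μ₁ μ₂ μ σ p hU hμ hσ hp hr
    refine one_sub_div_le_real_lowerBoundEvent fun hd => ?_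
    have hlog := hN d hd
    have hL0 : 0 < Real.log d := by linarith
    have hd0 : (0 : ℝ) < d := Nat.cast_pos.2 (Nat.pos_of_ne_zero (by rintro rfl; norm_num at hlog))
    -- Without factors the rank condition says nothing about the sign of `μ`, so `ρ = 0` is used.
    rcases Nat.eq_zero_or_pos r with rfl | hr0
    · have hF : FactorIncoherence U 0 :=
        ⟨le_rfl, fun l => l.elim0, fun l => l.elim0, fun l => l.elim0, by norm_num⟩
      refine hF.le_real_lowerBoundEvent hσ (by linarith) (by simpa using p.2.1) ?_
      simp only [mul_zero, add_zero, le_add_iff_nonneg_right]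
      positivity
    have hr1 : (1 : ℝ) ≤ r := by exact_mod_cast hr0
    rw [one_mul] at hr
    -- From `1 ≤ r ≤ √(d / (μ log d))` the radicand is positive, which forces `μ > 0`; squaring and
    -- `r ≤ r²` then bound `rμ/d`.
    have hpos : 0 < d / (μ * Real.log d) := Real.sqrt_pos.1 (by linarith)
    have hμL : 0 < μ * Real.log d := by
      by_contra! hneg
      exact absurd hpos (not_lt.2 (div_nonpos_of_nonneg_of_nonpos hd0.le hneg))
    have hμ0 : 0 < μ := pos_of_mul_pos_left hμL hL0.le
    have hr2 : (r : ℝ) ^ 2 * (μ * Real.log d) ≤ d := by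
      rw [← le_div_iff₀ hμL, ← Real.sq_sqrt hpos.le]
      exact pow_le_pow_left₀ (by linarith) hr 2
    have hrρ : r * (μ / d) ≤ 1 / Real.log d := by
      rw [← mul_div_assoc, div_le_div_iff₀ hd0 hL0]
      have := mul_le_mul_of_nonneg_right (le_self_pow₀ hr1 two_ne_zero) hμL.le
      linarith
    have hF := hU.factorIncoherence (μ := μ) (by rw [hμ]; simp) (by rw [hμ]; simp) hμ0.le
      (hrρ.trans (one_div_le_one_div_of_le two_pos hlog))
    refine hF.le_real_lowerBoundEvent hσ (by linarith) (le_trans (le_of_eq ?_) hp)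
      (by beta_reduce; linarith)
    field_simp
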